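/- **Theorem.** Let $N\ge 1$, $t_0>0$ and $\mathbf W_N=\{x\in\mathbb R^N: x_1<\dots<x_N\}$. Put $$h_N(x)=\prod_{1\le j<k\le N}(x_k-x_j),\qquad p(t,x|x')=\frac{1}{\sqrt{2\pi t}}\,e^{-(x-x')^2/2t},\qquad p_N(t,y|x)=\frac{h_N(y)}{h_N(x)}\det_{1\le j,k\le N}\big[p(t,y_j|x_k)\big],$$ $$\nu_0(x)=\frac{1}{C_N}\,t_0^{-N^2/2}\,e^{-|x|^2/2t_0}\,h_N(x)^2,\qquad C_N=(2\pi)^{N/2}\prod_{j=1}^N\Gamma(j).$$ Let $X(t)=(X_1(t),\dots,X_N(t))$, $t\ge t_0$, be the temporally homogeneous noncolliding Brownian motion started at time $t_0$ from the GUE eigenvalue distribution $\nu_0$, i.e. the process with continuous paths in $\mathbf W_N$ such that, for all $t_0<t_1<\dots<t_M$, $M\ge0$, the law of $(X(t_0),\dots,X(t_M))$ has on $\mathbf W_N^{M+1}$ the density $$\mathfrak p_N(x^{(0)},\dots,x^{(M)})=\nu_0(x^{(0)})\prod_{m=0}^{M-1}p_N\big(t_{m+1}-t_m,x^{(m+1)}\big|x^{(m)}\big).$$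 The same formula defines $\mathfrak p_N$ on $(\mathbb R^N)^{M+1}$ (by continuity, value $0$, where two coordinates of some $x^{(m)}$ coincide); it is symmetric in the coordinates of each $x^{(m)}$. For $0\le N_m\le N$ and $x^{(m)}_{N_m}=(x^{(m)}_1,\dots,x^{(m)}_{N_m})$, the $(N_0,\dots,N_M)$-multitime correlation function is $$\rho_N\big(t_0,x^{(0)}_{N_0};\dots;t_M,x^{(M)}_{N_M}\big)=\int_{\prod_{m}\mathbb R^{N-N_m}}\mathfrak p_N(x^{(0)},\dots,x^{(M)})\prod_{m=0}^M\frac{1}{(N-N_m)!}\prod_{j=N_m+1}^N dx^{(m)}_j .$$ Let $\varphi_k(x)=(\sqrt\pi\,2^kk!)^{-1/2}e^{-x^2/2}H_k(x)$ with $H_k(x)=e^{x^2}(-d/dx)^ke^{-x^2}$, and let $$\mathbb K_N(t_m,x;t_n,y)=\begin{cases}\displaystyle\frac1{\sqrt{2t_m}}\sum_{k=0}^{N-1}\Big(\frac{t_n}{t_m}\Big)^{k/2}\varphi_k\Big(\frac{x}{\sqrt{2t_m}}\Big)\varphi_k\Big(\frac{y}{\sqrt{2t_n}}\Big)&\text{if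 }m\le n,\\[3mm]\displaystyle-\frac1{\sqrt{2t_m}}\sum_{k=N}^{\infty}\Big(\frac{t_n}{t_m}\Big)^{k/2}\varphi_k\Big(\frac{x}{\sqrt{2t_m}}\Big)\varphi_k\Big(\frac{y}{\sqrt{2t_n}}\Big)&\text{if }m>n.\end{cases}$$ Then, for every $M\ge 0$ and $t_0<t_1<\dots<t_M<\infty$, the series in $\mathbb K_N$ converge, and the process is a finite determinantal process in the following sense. (i) For all continuous compactly supported $f_0,\dots,f_M:\mathbb R\to\mathbb R$ and all $\theta_0,\dots,\theta_M\in\mathbb R$, with $\chi_m=e^{\theta_mf_m}-1$, the multitime generating function is the Fredholm determinant $$\mathbf E\Big[\exp\Big\{\sum_{m=0}^M\theta_m\sum_{j=1}^Nf_m(X_j(t_m))\Big\}\Big]=\mathrm{Det}\big[\delta_{m,n}\delta(x-y)+\mathbb K_N(t_m,x;t_n,y)\chi_n(y)\big],$$ that is, the sum over all $(N_0,\dots,N_M)\in\mathbb N_0^{M+1}$ of $$\prod_{m=0}^M\frac1{N_m!}\int_{\prod_m\mathbb R^{N_m}}\prod_{m=0}^M\prod_{j=1}^{N_m}\chi_m(x^{(m)}_j)\,dx^{(m)}_j\;\det_{\substack{1\le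 j\le N_m,\,1\le k\le N_n\\0\le m,n\le M}}\big[\mathbb K_N(t_m,x^{(m)}_j;t_n,x^{(n)}_k)\big];$$ all these integrals and the sum converge absolutely, and the sum may be restricted to $0\le N_m\le N$. (ii) For all $0\le N_m\le N$ ($0\le m\le M$) and all points $x^{(m)}_j\in\mathbb R$, the integral defining $\rho_N$ converges absolutely and $$\rho_N\big(t_0,x^{(0)}_{N_0};\dots;t_M,x^{(M)}_{N_M}\big)=\det_{\substack{1\le j\le N_m,\,1\le k\le N_n\\0\le m,n\le M}}\big[\mathbb K_N(t_m,x^{(m)}_j;t_n,x^{(n)}_k)\big].$$ -/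

import Mathlib

open MeasureTheory

noncomputable section

namespace NoncollidingBM

/-- The Gaussian (heat) kernel `p(t, x | x')`. -/
def heatKernel (t x x' : ℝ) : ℝ :=
  (Real.sqrt (2 * Real.pi * t))⁻¹ * Real.exp (-(x - x') ^ 2 / (2 * t))

/-- The Weyl chamber `x₁ < x₂ < ⋯ < x_N` of type `A_{N-1}`. -/
def weylChamber (N : ℕ) : Set (Fin N → ℝ) := {x | StrictMono x}

/-- The product of differences `h_N(x) = ∏_{j<k} (x_k - x_j)`. -/
def vandermonde {N : ℕ} (x : Fin N → ℝ) : ℝ :=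
  ∏ j : Fin N, ∏ k ∈ Finset.Ioi j, (x k - x j)

/-- The Karlin-McGregor determinant `f_N(t, y | x) = det [p(t, y_j | x_k)]`, the transition
probability density of the Brownian motion absorbed at the walls of the Weyl chamber. -/
def karlinMcGregor {N : ℕ} (t : ℝ) (y x : Fin N → ℝ) : ℝ :=
  (Matrix.of fun j k : Fin N => heatKernel t (y j) (x k)).det

/-- The transition probability density `p_N(t, y | x) = (h_N(y) / h_N(x)) f_N(t, y | x)` of the
temporally homogeneous noncolliding Brownian motion. The formula is also used outside of the Weyl
chamber, where it is symmetric in the coordinates of `x` and in those of `y`. -/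
def transitionDensity {N : ℕ} (t : ℝ) (y x : Fin N → ℝ) : ℝ :=
  vandermonde y / vandermonde x * karlinMcGregor t y x

/-- The normalization constant `C_N = (2π)^{N/2} ∏_{j=1}^N Γ(j)`. -/
def gueConst (N : ℕ) : ℝ :=
  (2 * Real.pi) ^ ((N : ℝ) / 2) * ∏ j ∈ Finset.Icc 1 N, Real.Gamma (j : ℝ)

/-- The density of the (ordered) eigenvalues of the GUE with variance `t`. -/
def gueDensity (N : ℕ) (t : ℝ) (x : Fin N → ℝ) : ℝ :=
  1 / gueConst N * t ^ (-((N : ℝ) ^ 2 / 2)) * Real.exp (-(∑ j, x j ^ 2) / (2 * t)) *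
    vandermonde x ^ 2

/-- The multitime probability density, at the times `t 0 < t 1 < ⋯ < t M`, of the noncolliding
Brownian motion with density `ν₀` at time `t 0`. For symmetric `ν₀` it is a symmetric function of the
coordinates of each `x m`, that is, a function of the unlabelled configurations. -/
def multitimeDensity {N M : ℕ} (ν₀ : (Fin N → ℝ) → ℝ) (t : Fin (M + 1) → ℝ)
    (x : Fin (M + 1) → Fin N → ℝ) : ℝ :=
  ν₀ (x 0) *
    ∏ m : Fin M, transitionDensity (t m.succ - t m.castSucc) (x m.succ) (x m.castSucc)

/-- `X` is, under `P`, a temporally homogeneous noncolliding Brownian motion on the time interval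
`[t₀, ∞)` with density `ν₀` on the Weyl chamber at time `t₀`: a process with continuous paths in the
Weyl chamber whose finite dimensional distributions have the densities `multitimeDensity ν₀ t`. -/
structure IsNoncollidingBM {Ω : Type*} [MeasurableSpace Ω] (P : Measure Ω) {N : ℕ} (t₀ : ℝ)
    (ν₀ : (Fin N → ℝ) → ℝ) (X : ℝ → Ω → Fin N → ℝ) : Prop where
  measurable : ∀ t, t₀ ≤ t → Measurable (X t)
  continuous_paths : ∀ᵐ ω ∂P, ContinuousOn (fun t => X t ω) (Set.Ici t₀)
  noncolliding : ∀ᵐ ω ∂P, ∀ t, t₀ ≤ t → X t ω ∈ weylChamber N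
  law : ∀ (M : ℕ) (t : Fin (M + 1) → ℝ), StrictMono t → t 0 = t₀ →
    P.map (fun ω (m : Fin (M + 1)) => X (t m) ω) =
      ((volume : Measure (Fin (M + 1) → Fin N → ℝ)).restrict
        {x | ∀ m, x m ∈ weylChamber N}).withDensity
          (fun x => ENNReal.ofReal (multitimeDensity ν₀ t x))

/-- The configuration of `N` points that consists of the `n` points `x` followed by the `N - n`
points `y`. -/
def extendPoints {N n : ℕ} (x : Fin n → ℝ) (y : Fin (N - n) → ℝ) : Fin N → ℝ :=
  fun i => if h : (i : ℕ) < n then x ⟨i, h⟩ else y ⟨(i : ℕ) - n, by omega⟩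

/-- The `(n 0, …, n M)`-multitime correlation function at the points `x m j`, `j < n m`: the
remaining `N - n m` points of each of the configurations are integrated out of the multitime
density, with the factors `1 / (N - n m)!`. -/
def correlation {N M : ℕ} (ν₀ : (Fin N → ℝ) → ℝ) (t : Fin (M + 1) → ℝ) (n : Fin (M + 1) → ℕ)
    (x : ∀ m, Fin (n m) → ℝ) : ℝ :=
  ∫ y : (∀ m, Fin (N - n m) → ℝ),
    multitimeDensity ν₀ t (fun m => extendPoints (x m) (y m)) *
      ∏ m, (1 / ((N - n m).factorial : ℝ))

/-- The Hermite polynomial `H_n(x) = e^{x²} (-d/dx)^n e^{-x²}`. -/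
def hermiteH (n : ℕ) (x : ℝ) : ℝ :=
  Real.exp (x ^ 2) * ((-1) ^ n * iteratedDeriv n (fun y : ℝ => Real.exp (-y ^ 2)) x)

/-- The Hermite orthonormal function
`φ_n(x) = h_n^{-1/2} e^{-x²/2} H_n(x)`, where `h_n = √π 2^n n!`. -/
def hermiteFun (n : ℕ) (x : ℝ) : ℝ :=
  1 / Real.sqrt (Real.sqrt Real.pi * 2 ^ n * (n.factorial : ℝ)) * Real.exp (-x ^ 2 / 2) *
    hermiteH n x

/-- The `k`-th term `(t/s)^{k/2} φ_k(x/√(2s)) φ_k(y/√(2t))` of the extended Hermite kernel. -/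
def kernelTerm (s x t y : ℝ) (k : ℕ) : ℝ :=
  (t / s) ^ ((k : ℝ) / 2) * hermiteFun k (x / Real.sqrt (2 * s)) *
    hermiteFun k (y / Real.sqrt (2 * t))

/-- The extended Hermite kernel `𝕂_N(s, x; t, y)`. -/
def hermiteKernel (N : ℕ) (s x t y : ℝ) : ℝ :=
  if s ≤ t then 1 / Real.sqrt (2 * s) * ∑ k ∈ Finset.range N, kernelTerm s x t y k
  else -(1 / Real.sqrt (2 * s)) * ∑' k : ℕ, kernelTerm s x t y (N + k)

/-- The block matrix `[K m (x m j) m' (x m' k)]`, with rows `(m, j)` and columns `(m', k)`. -/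
def kernelMatrix {M : ℕ} (K : Fin (M + 1) → ℝ → Fin (M + 1) → ℝ → ℝ) {n : Fin (M + 1) → ℕ}
    (x : ∀ m, Fin (n m) → ℝ) : Matrix (Σ m, Fin (n m)) (Σ m, Fin (n m)) ℝ :=
  Matrix.of fun a b => K a.1 (x a.1 a.2) b.1 (x b.1 b.2)

/-- The term of the Fredholm expansion of `Det [δ_{m,m'} δ(x - y) + K m x m' y]` with `n m` points
at the time index `m`. -/
def fredholmTerm {M : ℕ} (K : Fin (M + 1) → ℝ → Fin (M + 1) → ℝ → ℝ) (n : Fin (M + 1) → ℕ) : ℝ :=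
  (∏ m, (1 / ((n m).factorial : ℝ))) *
    ∫ x : (∀ m, Fin (n m) → ℝ), (kernelMatrix K x).det

/-- The Fredholm determinant `Det [δ_{m,m'} δ(x - y) + K m x m' y]` of a matrix-kernel. Collecting
the `n!/∏ (n m)!` equal terms, it is the series of the
`(1/n!) ∑_{m₁,…,mₙ} ∫ det [K mᵢ xᵢ mⱼ xⱼ] dx₁ ⋯ dxₙ`. -/
def fredholmDet {M : ℕ} (K : Fin (M + 1) → ℝ → Fin (M + 1) → ℝ → ℝ) : ℝ :=
  ∑' n : Fin (M + 1) → ℕ, fredholmTerm K n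

end NoncollidingBM

end

/-!
The generating function and the correlation functions are computed from one fact: the multitime
density is itself a determinant of the kernel, taken at `N` points for each of the times.

**The kernel.** With the powers of `t n / t m` distributed over the two factors, the kernel has the
form `K = ∑ k, Q m k x * P n k y - 1_{n < m} T m n x y`. Here `Q` and `P` are rescaled Hermite
functions, biorthogonal at each time, and `T` is the Mehler kernel at `√(t n / t m)`: by Mehler's formula
(`hasSum_mehlerKernel`) the series over `k ≥ N` is the whole series, in closed form, minus its first
`N` terms. The functions `T` compose like transition densities and carry the `Q`s and the `P`s at one
time to those at another. These properties are all that is used of the kernel, and are the content of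
the structure `ExtendedKernel`. Mehler's formula is obtained from the Fourier representation of
`H k (x)` and the generating function of the `H k (y)`.

**Full configurations.** With `N` points at each time, `det K` is a Schur complement of a block
triangular matrix, and it factorizes into `det Q` at the first time, the determinants of the
transitions, and `det P` at the last time (`ExtendedKernel.detK_full`). Each of `det Q` and `det P` is
a Vandermonde product times a Gaussian factor, and `T` is the heat kernel up to Gaussian factors that
telescope. So the product is the multitime density (`multitimeDensity_eq_detK`).

**Correlation functions.** Integrating out one point at time `m` multiplies the determinant by `N`
minus the number of the other points at time `m` (`ExtendedKernel.integral_detK_sum_unit`). Indeed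
`∫ K(a, z) K(z, b) dz` at time `m` is `K(a, b)` times the sum of a function of the time of `b` and a
function of the time of `a`, and the trace of the adjugate of `K` against such a matrix is a multiple
of `det K`. Repeating this from the full configuration gives the correlation functions, and the total
mass `N! ^ (M + 1)` of the density.

**Generating function.** The expectation is an integral over ordered configurations; by symmetry it is
`1 / N! ^ (M + 1)` of the integral over all configurations. The product of the factors `1 + χ` is
expanded into a sum over subsets of the points, and the points without a factor `χ` are integrated
out (`ExtendedKernel.integral_prod_one_add_mul_detK`). This gives the part of the Fredholm expansion
with at most `N` points at each time, and the other terms vanish (`ExtendedKernel.detK_eq_zero`). The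
law of the process involves the positive part of the density only; that the density is nonnegative
almost everywhere follows from its total mass (`ae_nonneg_of_integral_eq_one`).
-/

namespace NoncollidingBM

/-! ### Determinants -/

/-- The determinant of a matrix with one more row and column, in terms of the adjugate of `A`. No
invertibility of `A` is needed. -/
theorem det_fromBlocks_replicateCol_replicateRow {n R : Type*} [Fintype n] [DecidableEq n]
    [CommRing R] (A : Matrix n n R) (b c : n → R) (d : R) :
    (Matrix.fromBlocks A (Matrix.replicateCol Unit b) (Matrix.replicateRow Unit c)
      (Matrix.of fun _ _ => d)).det =
      d * A.det - ∑ i, ∑ j, c i * A.adjugate i j * b j := by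
  set B := Matrix.fromBlocks A (Matrix.replicateCol Unit b) (Matrix.replicateRow Unit c)
      (Matrix.of fun _ _ => d) with hB
  rw [Matrix.det_eq_sum_mul_adjugate_row B (Sum.inr ()), Fintype.sum_sum_type]
  have h1 : B.adjugate (Sum.inr ()) (Sum.inr ()) = A.det := by
    rw [Matrix.adjugate_apply]
    have : B.updateRow (Sum.inr ()) (Pi.single (Sum.inr ()) 1) =
        Matrix.fromBlocks A (Matrix.replicateCol Unit b) 0 1 := by
      ext i j
      rcases i with i | i <;> rcases j with j | j <;> simp [hB, Matrix.updateRow_apply]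
    rw [this, Matrix.det_fromBlocks_zero₂₁]
    simp
  have h2 : ∀ i, B.adjugate (Sum.inl i) (Sum.inr ()) = -∑ j, A.adjugate i j * b j := by
    intro i
    have e1 : ∑ j, A.adjugate i j * b j = (A.updateCol i b).det := by
      rw [← Matrix.cramer_apply, Matrix.cramer_eq_adjugate_mulVec]
      rfl
    have e2 : (B.updateRow (Sum.inr ()) (Pi.single (Sum.inl i) 1)).submatrix id
        (Equiv.swap (Sum.inl i) (Sum.inr ())) =
        Matrix.fromBlocks (A.updateCol i b) (Matrix.replicateCol Unit (A.col i)) 0 1 := by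
      ext k l
      rcases k with k | k <;> rcases l with l | l
      · by_cases h : l = i
        · subst h; simp [hB, Matrix.updateRow_apply]
        · rw [Matrix.submatrix_apply, Equiv.swap_apply_of_ne_of_ne (by simpa using h) (by simp)]
          simp [hB, Matrix.updateRow_apply, h]
      · simp [hB, Matrix.updateRow_apply]
      · by_cases h : l = i
        · subst h; simp [hB, Matrix.updateRow_apply]
        · rw [Matrix.submatrix_apply, Equiv.swap_apply_of_ne_of_ne (by simpa using h) (by simp)]
          simp [hB, Matrix.updateRow_apply, h]
      · simp [hB, Matrix.updateRow_apply]
    have e3 := congrArg Matrix.det e2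
    rw [Matrix.det_permute', Matrix.det_fromBlocks_zero₂₁, Equiv.Perm.sign_swap (by simp)] at e3
    rw [Matrix.adjugate_apply, e1]
    simp at e3
    rw [← e3, neg_neg]
  simp only [h1, h2, Finset.univ_unique, Finset.sum_singleton]
  rw [show B (Sum.inr ()) (Sum.inr ()) = d from rfl, add_comm, sub_eq_add_neg,
    ← Finset.sum_neg_distrib]
  congr 1
  refine Finset.sum_congr rfl fun i _ => ?_
  rw [show B (Sum.inr ()) (Sum.inl i) = c i from rfl, mul_neg, Finset.mul_sum]
  simp [mul_assoc]

/-- The trace against `adj A` of `A D + D' A`, for diagonal matrices `D` and `D'`. -/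
theorem sum_adjugate_mul_diagonal {n R : Type*} [Fintype n] [DecidableEq n] [CommRing R]
    (A : Matrix n n R) (d d' : n → R) :
    ∑ i, ∑ j, A.adjugate i j * (A j i * (d i + d' j)) = A.det * ∑ i, (d i + d' i) := by
  have h1 : ∀ i, ∑ j, A.adjugate i j * A j i = A.det := fun i => by
    have := congrFun (congrFun (Matrix.adjugate_mul A) i) i
    simpa [Matrix.mul_apply] using this
  have h2 : ∀ j, ∑ i, A.adjugate i j * A j i = A.det := fun j => by
    have := congrFun (congrFun (Matrix.mul_adjugate A) j) j
    simpa [Matrix.mul_apply, mul_comm] using this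
  have h3 : ∑ i, ∑ j, A.adjugate i j * (A j i * (d i + d' j)) =
      ∑ i, d i * ∑ j, A.adjugate i j * A j i + ∑ j, d' j * ∑ i, A.adjugate i j * A j i := by
    simp only [Finset.mul_sum]
    rw [Finset.sum_comm (f := fun j i => d' j * (A.adjugate i j * A j i)),
      ← Finset.sum_add_distrib]
    refine Finset.sum_congr rfl fun i _ => ?_
    rw [← Finset.sum_add_distrib]
    refine Finset.sum_congr rfl fun j _ => ?_
    ring
  rw [h3]
  simp only [h1, h2, ← Finset.sum_mul, Finset.sum_add_distrib]
  ring

/-- A matrix all of whose entries in row `i` are bounded by `g i` has determinant at most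
`n! ∏ g i`. -/
theorem abs_det_le_of_row_bound {n : Type*} [Fintype n] [DecidableEq n] (A : Matrix n n ℝ)
    (g : n → ℝ) (h : ∀ i j, |A i j| ≤ g i) :
    |A.det| ≤ (Fintype.card n).factorial * ∏ i, g i := by
  rw [Matrix.det_apply]
  refine (Finset.abs_sum_le_sum_abs _ _).trans ?_
  have : ∀ σ : Equiv.Perm n, |Equiv.Perm.sign σ • ∏ i, A (σ i) i| ≤ ∏ i, g i := by
    intro σ
    have h1 : |Equiv.Perm.sign σ • ∏ i, A (σ i) i| = ∏ i, |A (σ i) i| := by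
      rcases Int.units_eq_one_or (Equiv.Perm.sign σ) with h | h <;>
        simp [h, Finset.abs_prod]
    rw [h1, ← Equiv.prod_comp σ g]
    exact Finset.prod_le_prod (fun _ _ => abs_nonneg _) fun i _ => h _ _
  refine (Finset.sum_le_sum fun σ _ => this σ).trans ?_
  simp [Fintype.card_perm]

/-! ### Extended kernels and their correlation functions -/

/-- The data of an extended kernel of rank `N` on a linearly ordered set `I` of times: functions
`Q m k` and `P m k` that are biorthogonal at each time `m`, and transition functions `T m n` for
`n < m` with the Chapman-Kolmogorov property, which transport the `Q n k` to the `Q m k` and the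
`P m k` back to the `P n k`. The `Q m k` and `T m n` are dominated, in their first variable, by one
integrable function `g`; the `P m k` are bounded by `C`. All integrability and absolute convergence
comes from these two bounds. -/
structure ExtendedKernel (I : Type*) [LinearOrder I] (N : ℕ) where
  Q : I → Fin N → ℝ → ℝ
  P : I → Fin N → ℝ → ℝ
  T : I → I → ℝ → ℝ → ℝ
  g : ℝ → ℝ
  C : ℝ
  continuous_Q : ∀ m k, Continuous (Q m k)
  continuous_P : ∀ m k, Continuous (P m k)
  continuous_T : ∀ m n, n < m → Continuous fun z : ℝ × ℝ => T m n z.1 z.2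
  integrable_g : Integrable g
  abs_Q_le : ∀ m k x, |Q m k x| ≤ g x
  abs_P_le : ∀ m k x, |P m k x| ≤ C
  abs_T_le : ∀ m n, n < m → ∀ x y, |T m n x y| ≤ g x
  integral_P_mul_Q : ∀ m j k, ∫ z, P m j z * Q m k z = if j = k then 1 else 0
  integral_T_mul_Q : ∀ m n, n < m → ∀ k x, ∫ z, T m n x z * Q n k z = Q m k x
  integral_P_mul_T : ∀ m n, n < m → ∀ k y, ∫ z, P m k z * T m n z y = P n k y
  integral_T_mul_T : ∀ l m n, n < m → m < l → ∀ x y, ∫ z, T l m x z * T m n z y = T l n x y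

namespace ExtendedKernel

variable {I : Type*} [LinearOrder I] {N : ℕ} (E : ExtendedKernel I N)

/-- The extended kernel `∑ k, Q m k x * P n k y`, from which `T m n x y` is subtracted when
`n < m`. -/
def K (m : I) (x : ℝ) (n : I) (y : ℝ) : ℝ :=
  ∑ k, E.Q m k x * E.P n k y - if n < m then E.T m n x y else 0

/-- The matrix of the kernel at the points `x a` at the times `τ a`. -/
def kernelMat {ι : Type*} (τ : ι → I) (x : ι → ℝ) : Matrix ι ι ℝ :=
  Matrix.of fun a b => E.K (τ a) (x a) (τ b) (x b)

/-- The determinant of the kernel at the points `x a` at the times `τ a`. Equality on `ι` is decided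
classically, so that index types can be exchanged along equivalences. -/
noncomputable def detK {ι : Type*} [Fintype ι] (τ : ι → I) (x : ι → ℝ) : ℝ :=
  by classical exact (E.kernelMat τ x).det

theorem detK_eq {ι : Type*} [Fintype ι] [DecidableEq ι] (τ : ι → I) (x : ι → ℝ) :
    E.detK τ x = (E.kernelMat τ x).det := by
  unfold detK
  congr!

theorem detK_comp_equiv {ι κ : Type*} [Fintype ι] [Fintype κ] (e : ι ≃ κ) (τ : κ → I) (x : κ → ℝ) :
    E.detK (τ ∘ e) (x ∘ e) = E.detK τ x := by
  classical
  rw [detK_eq, detK_eq, ← Matrix.det_submatrix_equiv_self e]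
  rfl

theorem continuous_K (m n : I) : Continuous fun z : ℝ × ℝ => E.K m z.1 n z.2 := by
  unfold K
  refine Continuous.sub (continuous_finsetSum _ fun k _ =>
    ((E.continuous_Q m k).comp continuous_fst).mul ((E.continuous_P n k).comp continuous_snd)) ?_
  split_ifs with h
  · exact E.continuous_T m n h
  · exact continuous_const

theorem abs_K_le (m : I) (x : ℝ) (n : I) (y : ℝ) : |E.K m x n y| ≤ (N * E.C + 1) * |E.g x| := by
  unfold K
  refine (abs_sub _ _).trans ?_
  have h1 : |∑ k, E.Q m k x * E.P n k y| ≤ N * E.C * |E.g x| := by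
    refine (Finset.abs_sum_le_sum_abs _ _).trans ?_
    calc ∑ k, |E.Q m k x * E.P n k y| ≤ ∑ _k : Fin N, |E.g x| * E.C :=
          Finset.sum_le_sum fun k _ => by
            rw [abs_mul]
            exact mul_le_mul ((E.abs_Q_le m k x).trans (le_abs_self _)) (E.abs_P_le n k y)
              (abs_nonneg _) (abs_nonneg _)
      _ = N * E.C * |E.g x| := by simp; ring
  have h2 : |if n < m then E.T m n x y else 0| ≤ |E.g x| := by
    split_ifs with h
    · exact (E.abs_T_le m n h x y).trans (le_abs_self _)
    · simp
  linarith

/-- A continuous function that is the product of a bounded factor and of one dominated by `g` is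
integrable. -/
theorem integrable_mul_of_le {u v : ℝ → ℝ} {B : ℝ} (hu : Continuous u) (hv : Continuous v)
    (hub : ∀ z, |u z| ≤ B) (hvb : ∀ z, |v z| ≤ E.g z) : Integrable fun z => u z * v z :=
  (E.integrable_g.mono hv.aestronglyMeasurable (ae_of_all _ fun z => by
    simpa only [Real.norm_eq_abs] using (hvb z).trans (le_abs_self _))).bdd_mul
    hu.aestronglyMeasurable (ae_of_all _ hub)

theorem continuous_T_left {m n : I} (h : n < m) (y : ℝ) : Continuous fun z => E.T m n z y :=
  (E.continuous_T m n h).comp (continuous_id.prodMk continuous_const)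

theorem continuous_T_right {m n : I} (h : n < m) (x : ℝ) : Continuous fun z => E.T m n x z :=
  (E.continuous_T m n h).comp (continuous_const.prodMk continuous_id)

/-- Composition of the kernel with itself at an intermediate time `m`: the result is the kernel, up
to a factor that is the sum of a function of `l` and a function of `p`. -/
theorem integral_K_mul_K (p m l : I) (x y : ℝ) :
    Integrable (fun z => E.K p x m z * E.K m z l y) ∧
    ∫ z, E.K p x m z * E.K m z l y =
      E.K p x l y * ((if m ≤ l then 1 else 0) + (if m < p then -1 else 0)) := by
  have iPQ : ∀ j k, Integrable fun z => E.P m j z * E.Q m k z := fun j k =>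
    E.integrable_mul_of_le (E.continuous_P m j) (E.continuous_Q m k) (E.abs_P_le m j)
      (E.abs_Q_le m k)
  have i1 : ∀ k j : Fin N, Integrable fun z =>
      (E.Q p k x * E.P m k z) * (E.Q m j z * E.P l j y) := fun k j => by
    refine ((iPQ k j).const_mul (E.Q p k x * E.P l j y)).congr (ae_of_all _ fun z => ?_)
    ring
  have e1 : ∀ k j : Fin N, ∫ z, (E.Q p k x * E.P m k z) * (E.Q m j z * E.P l j y) =
      if k = j then E.Q p k x * E.P l j y else 0 := fun k j => by
    rw [← mul_boole, ← E.integral_P_mul_Q m k j, ← integral_const_mul]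
    exact integral_congr_ae (ae_of_all _ fun z => by ring)
  have i11 : Integrable fun z => (∑ k, E.Q p k x * E.P m k z) * ∑ j, E.Q m j z * E.P l j y := by
    simp only [Finset.sum_mul_sum]
    exact integrable_finsetSum _ fun k _ => integrable_finsetSum _ fun j _ => i1 k j
  have e11 : ∫ z, (∑ k, E.Q p k x * E.P m k z) * ∑ j, E.Q m j z * E.P l j y =
      ∑ k, E.Q p k x * E.P l k y := by
    simp only [Finset.sum_mul_sum]
    rw [integral_finsetSum _ fun k _ => integrable_finsetSum _ fun j _ => i1 k j]
    refine Finset.sum_congr rfl fun k _ => ?_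
    rw [integral_finsetSum _ fun j _ => i1 k j]
    simp [e1]
  have T1 : l < m → (Integrable fun z => (∑ k, E.Q p k x * E.P m k z) * E.T m l z y) ∧
      ∫ z, (∑ k, E.Q p k x * E.P m k z) * E.T m l z y = ∑ k, E.Q p k x * E.P l k y := by
    intro h
    have i : ∀ k, Integrable fun z => (E.Q p k x * E.P m k z) * E.T m l z y := fun k => by
      simp only [mul_assoc]
      exact (E.integrable_mul_of_le (E.continuous_P m k) (E.continuous_T_left h y)
        (E.abs_P_le m k) fun z => E.abs_T_le m l h z y).const_mul _
    simp only [Finset.sum_mul]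
    refine ⟨integrable_finsetSum _ fun k _ => i k, ?_⟩
    rw [integral_finsetSum _ fun k _ => i k]
    refine Finset.sum_congr rfl fun k _ => ?_
    simp only [mul_assoc]
    rw [integral_const_mul, E.integral_P_mul_T m l h]
  have T2 : m < p → (Integrable fun z => E.T p m x z * ∑ j, E.Q m j z * E.P l j y) ∧
      ∫ z, E.T p m x z * ∑ j, E.Q m j z * E.P l j y = ∑ k, E.Q p k x * E.P l k y := by
    intro h
    have i : ∀ k, Integrable fun z => E.T p m x z * (E.Q m k z * E.P l k y) := fun k => by
      simp only [← mul_assoc]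
      exact (E.integrable_mul_of_le (E.continuous_T_right h x) (E.continuous_Q m k)
        (fun z => E.abs_T_le p m h x z) (E.abs_Q_le m k)).mul_const _
    simp only [Finset.mul_sum]
    refine ⟨integrable_finsetSum _ fun k _ => i k, ?_⟩
    rw [integral_finsetSum _ fun k _ => i k]
    refine Finset.sum_congr rfl fun k _ => ?_
    simp only [← mul_assoc]
    rw [integral_mul_const, E.integral_T_mul_Q p m h]
  have T3 : m < p → l < m → (Integrable fun z => E.T p m x z * E.T m l z y) := fun h h' =>
    E.integrable_mul_of_le (E.continuous_T_right h x) (E.continuous_T_left h' y)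
      (fun z => E.abs_T_le p m h x z) fun z => E.abs_T_le m l h' z y
  unfold K
  by_cases hp : m < p <;> by_cases hl : l < m
  · obtain ⟨a1, b1⟩ := T1 hl
    obtain ⟨a2, b2⟩ := T2 hp
    have a3 := T3 hp hl
    simp only [hp, hl, hl.trans hp, not_le.2 hl, if_true, if_false, sub_mul, mul_sub]
    refine ⟨(i11.sub a2).sub (a1.sub a3), ?_⟩
    have h := integral_sub (i11.sub a2) (a1.sub a3)
    simp only [Pi.sub_apply] at h
    rw [h, integral_sub i11 a2, integral_sub a1 a3, e11, b1, b2,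
      E.integral_T_mul_T p m l hl hp]
    ring
  · obtain ⟨a2, b2⟩ := T2 hp
    simp only [hp, hl, not_lt.1 hl, if_true, if_false, sub_mul, sub_zero]
    refine ⟨i11.sub a2, ?_⟩
    rw [integral_sub i11 a2, e11, b2]
    ring
  · obtain ⟨a1, b1⟩ := T1 hl
    simp only [hp, hl, not_le.2 hl, if_true, if_false, mul_sub, sub_zero]
    refine ⟨i11.sub a1, ?_⟩
    rw [integral_sub i11 a1, e11, b1]
    ring
  · have hlp : ¬ l < p := by
      rw [not_lt] at *
      exact hp.trans hl
    simp only [hp, hl, hlp, not_lt.1 hl, if_true, if_false, sub_zero]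
    exact ⟨i11, by rw [e11]; ring⟩

/-- The total mass of the diagonal of the kernel is its rank. -/
theorem integral_K_diag (m : I) :
    Integrable (fun z => E.K m z m z) ∧ ∫ z, E.K m z m z = N := by
  have iPQ : ∀ k, Integrable fun z => E.Q m k z * E.P m k z := fun k => by
    simp only [mul_comm (E.Q m k _)]
    exact E.integrable_mul_of_le (E.continuous_P m k) (E.continuous_Q m k) (E.abs_P_le m k)
      (E.abs_Q_le m k)
  simp only [K, lt_self_iff_false, if_false, sub_zero]
  refine ⟨integrable_finsetSum _ fun k _ => iPQ k, ?_⟩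
  rw [integral_finsetSum _ fun k _ => iPQ k]
  simp only [mul_comm (E.Q m _ _), E.integral_P_mul_Q, if_true]
  simp

/-- Integrating out one point at time `m` multiplies the determinant by `N` minus the number of the
other points at time `m`. The bordered determinant is `K(z, z) det A` minus the trace of `adj A`
against a rank one matrix; by `integral_K_mul_K` the latter integrates to a matrix `A D + D' A` with
diagonal `D` and `D'`, whose joint trace is the number of points at time `m`. -/
theorem integral_detK_sum_unit {ι : Type*} [Fintype ι] (τ : ι → I) (m : I) (x : ι → ℝ) :
    ∫ z, E.detK (Sum.elim τ fun _ : Unit => m) (Sum.elim x fun _ => z) =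
      (N - (Finset.univ.filter fun a => τ a = m).card) * E.detK τ x := by
  classical
  simp only [detK_eq]
  set A := E.kernelMat τ x with hA
  have h : ∀ z, (E.kernelMat (Sum.elim τ fun _ : Unit => m) (Sum.elim x fun _ => z)).det =
      E.K m z m z * A.det -
        ∑ i, ∑ j, A.adjugate i j * (E.K (τ j) (x j) m z * E.K m z (τ i) (x i)) := by
    intro z
    have : E.kernelMat (Sum.elim τ fun _ : Unit => m) (Sum.elim x fun _ => z) =
        Matrix.fromBlocks A (Matrix.replicateCol Unit fun a => E.K (τ a) (x a) m z)
          (Matrix.replicateRow Unit fun a => E.K m z (τ a) (x a))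
          (Matrix.of fun _ _ => E.K m z m z) := by
      ext i j
      rcases i with i | i <;> rcases j with j | j <;> rfl
    rw [this, det_fromBlocks_replicateCol_replicateRow]
    congr 1
    exact Finset.sum_congr rfl fun i _ => Finset.sum_congr rfl fun j _ => by ring
  simp only [h]
  have i2 : ∀ i j, Integrable fun z =>
      A.adjugate i j * (E.K (τ j) (x j) m z * E.K m z (τ i) (x i)) := fun i j =>
    (E.integral_K_mul_K _ _ _ _ _).1.const_mul _
  rw [integral_sub ((E.integral_K_diag m).1.mul_const _)
    (integrable_finsetSum _ fun i _ => integrable_finsetSum _ fun j _ => i2 i j),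
    integral_mul_const, (E.integral_K_diag m).2,
    integral_finsetSum _ fun i _ => integrable_finsetSum _ fun j _ => i2 i j]
  have h3 : ∀ i, ∫ z, ∑ j, A.adjugate i j * (E.K (τ j) (x j) m z * E.K m z (τ i) (x i)) =
      ∑ j, A.adjugate i j * (A j i *
        ((if m ≤ τ i then 1 else 0) + (if m < τ j then -1 else 0))) := fun i => by
    rw [integral_finsetSum _ fun j _ => i2 i j]
    refine Finset.sum_congr rfl fun j _ => ?_
    rw [integral_const_mul, (E.integral_K_mul_K _ _ _ _ _).2]
    rfl
  simp only [h3]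
  rw [sum_adjugate_mul_diagonal A (fun i => if m ≤ τ i then 1 else 0)
    (fun j => if m < τ j then -1 else 0)]
  have h4 : ∀ i, (((if m ≤ τ i then 1 else 0) + (if m < τ i then -1 else 0) : ℝ)) =
      if τ i = m then 1 else 0 := fun i => by
    rcases lt_trichotomy m (τ i) with h | h | h
    · simp [h, h.le, h.ne']
    · simp [h]
    · simp [h.not_ge, h.not_gt, h.ne]
  simp only [h4, Finset.sum_boole]
  ring

/-- There are never more than `N` points at the same time. If `ι` has more than `N` points at time
`m`, then by a dimension count there is a nonzero row vector `v`, supported on the points up to time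
`m`, with `v Q = 0` and with `(v K) b = 0` for all `b` before time `m`. At the points `b` from time
`m` on, no transition function enters `v K`, so that `(v K) b = (v Q) P = 0` there too. -/
theorem detK_eq_zero {ι : Type*} [Fintype ι] (τ : ι → I) (m : I) (x : ι → ℝ)
    (h : N < (Finset.univ.filter fun a => τ a = m).card) : E.detK τ x = 0 := by
  classical
  rw [detK_eq]
  set A := E.kernelMat τ x with hA
  -- The conditions on `v`: one for each point not at time `m`, and `N` for `v Q = 0`.
  let φ : (ι → ℝ) →ₗ[ℝ] ({a // τ a ≠ m} → ℝ) × (Fin N → ℝ) :=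
    LinearMap.prod
      (LinearMap.pi fun b => if τ b < m then
        (LinearMap.proj (b : ι)).comp A.vecMulLinear else LinearMap.proj (b : ι))
      (LinearMap.pi fun k => ∑ a, E.Q (τ a) k (x a) • LinearMap.proj a)
  have hker : LinearMap.ker φ ≠ ⊥ := by
    refine LinearMap.ker_ne_bot_of_finrank_lt ?_
    have h1 : Fintype.card {a // τ a ≠ m} =
        Fintype.card ι - (Finset.univ.filter fun a => τ a = m).card := by
      rw [Fintype.card_subtype_compl (fun a => τ a = m), Fintype.card_subtype]
    have h2 : (Finset.univ.filter fun a => τ a = m).card ≤ Fintype.card ι := Finset.card_le_univ _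
    rw [Module.finrank_prod, Module.finrank_fintype_fun_eq_card, Module.finrank_fintype_fun_eq_card,
      Module.finrank_fintype_fun_eq_card, Fintype.card_fin, h1]
    omega
  obtain ⟨v, hv, hv0⟩ := Submodule.exists_mem_ne_zero_of_ne_bot hker
  rw [LinearMap.mem_ker] at hv
  have hQ : ∀ k, ∑ a, v a * E.Q (τ a) k (x a) = 0 := fun k => by
    have := congrFun (congrArg Prod.snd hv) k
    simpa [φ, mul_comm] using this
  have hlt : ∀ b, τ b < m → Matrix.vecMul v A b = 0 := fun b hb => by
    have := congrFun (congrArg Prod.fst hv) ⟨b, hb.ne⟩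
    simpa [φ, hb] using this
  have hgt : ∀ b, m < τ b → v b = 0 := fun b hb => by
    have := congrFun (congrArg Prod.fst hv) ⟨b, hb.ne'⟩
    simpa [φ, hb.not_gt] using this
  refine Matrix.exists_vecMul_eq_zero_iff.1 ⟨v, hv0, ?_⟩
  funext b
  rcases lt_or_ge (τ b) m with hb | hb
  · exact hlt b hb
  · have : ∀ a, v a * A a b = ∑ k, (v a * E.Q (τ a) k (x a)) * E.P (τ b) k (x b) := fun a => by
      rcases lt_or_ge m (τ a) with ha | ha
      · simp [hgt a ha]
      · simp [hA, kernelMat, K, (ha.trans hb).not_gt, Finset.mul_sum, mul_assoc]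
    simp only [Matrix.vecMul, dotProduct, this]
    rw [Finset.sum_comm]
    simp [← Finset.sum_mul, hQ]

end ExtendedKernel

/-! ### Changes of variables on spaces of finite families -/

theorem measurePreserving_comp_equiv {ι κ : Type*} [Fintype ι] [Fintype κ] (e : ι ≃ κ) :
    MeasurePreserving (fun x : κ → ℝ => x ∘ e) ∧ MeasurableEmbedding (fun x : κ → ℝ => x ∘ e) :=
  ⟨(volume_measurePreserving_piCongrLeft (fun _ : κ => ℝ) e).symm,
    (MeasurableEquiv.piCongrLeft (fun _ : κ => ℝ) e).symm.measurableEmbedding⟩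

theorem integral_comp_equiv {ι κ : Type*} [Fintype ι] [Fintype κ] (e : ι ≃ κ)
    (F : (ι → ℝ) → ℝ) : ∫ x : κ → ℝ, F (x ∘ e) = ∫ x : ι → ℝ, F x :=
  (measurePreserving_comp_equiv e).1.integral_comp (measurePreserving_comp_equiv e).2 F

theorem integral_sum_elim {ι κ : Type*} [Fintype ι] [Fintype κ] {F : (ι ⊕ κ → ℝ) → ℝ}
    (hF : Integrable F) :
    ∫ x, F x = ∫ x : ι → ℝ, ∫ y : κ → ℝ, F (Sum.elim x y) := by
  have hp := volume_measurePreserving_sumPiEquivProdPi_symm fun _ : ι ⊕ κ => ℝ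
  have he := (MeasurableEquiv.sumPiEquivProdPi fun _ : ι ⊕ κ => ℝ).symm.measurableEmbedding
  have h : ∀ z, (MeasurableEquiv.sumPiEquivProdPi fun _ : ι ⊕ κ => ℝ).symm z =
      Sum.elim z.1 z.2 := fun z => by
    funext a
    rcases a with a | a <;> rfl
  rw [← hp.integral_comp he]
  rw [← hp.integrable_comp_emb he] at hF
  simp only [Function.comp_def, h] at hF ⊢
  exact integral_prod _ hF

theorem integral_unit_pi (F : (Unit → ℝ) → ℝ) : ∫ y, F y = ∫ z : ℝ, F fun _ => z :=
  ((volume_preserving_funUnique Unit ℝ).symm.integral_comp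
    (MeasurableEquiv.funUnique Unit ℝ).symm.measurableEmbedding F).symm

theorem measurePreserving_sigma_uncurry {ι : Type*} [Fintype ι] (κ : ι → Type*)
    [∀ i, Fintype (κ i)] :
    MeasurePreserving (MeasurableEquiv.piCurry fun (i : ι) (_ : κ i) => ℝ).symm where
  measurable := (MeasurableEquiv.piCurry fun (i : ι) (_ : κ i) => ℝ).symm.measurable
  map_eq := by
    refine (Measure.pi_eq fun s _ => ?_).symm
    have h : (MeasurableEquiv.piCurry fun (i : ι) (_ : κ i) => ℝ).symm ⁻¹' Set.univ.pi s =
        Set.univ.pi fun i => Set.univ.pi fun j => s ⟨i, j⟩ := by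
      ext x
      simp only [Set.mem_preimage, Set.mem_pi, Set.mem_univ, true_imp_iff, Sigma.forall]
      rfl
    rw [MeasurableEquiv.map_apply, h, volume_pi_pi, Fintype.prod_sigma]
    simp only [volume_pi_pi]

theorem integral_sigma_uncurry {ι : Type*} [Fintype ι] {κ : ι → Type*} [∀ i, Fintype (κ i)]
    (F : ((Σ i, κ i) → ℝ) → ℝ) :
    ∫ x : ∀ i, κ i → ℝ, F (fun a => x a.1 a.2) = ∫ x, F x :=
  (measurePreserving_sigma_uncurry κ).integral_comp
    (MeasurableEquiv.piCurry fun (i : ι) (_ : κ i) => ℝ).symm.measurableEmbedding F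

theorem integrable_sigma_uncurry {ι : Type*} [Fintype ι] {κ : ι → Type*} [∀ i, Fintype (κ i)]
    {F : ((Σ i, κ i) → ℝ) → ℝ} (hF : Integrable F) :
    Integrable fun x : ∀ i, κ i → ℝ => F (fun a => x a.1 a.2) :=
  ((measurePreserving_sigma_uncurry κ).integrable_comp_emb
    (MeasurableEquiv.piCurry fun (i : ι) (_ : κ i) => ℝ).symm.measurableEmbedding).2 hF

/-! ### Integration of the determinants over some of the points -/

/-- The number of indices at time `m`. -/
def count {ι I : Type*} [Fintype ι] [DecidableEq I] (τ : ι → I) (m : I) : ℕ :=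
  (Finset.univ.filter fun a => τ a = m).card

theorem count_sum_elim {ι κ I : Type*} [Fintype ι] [Fintype κ] [DecidableEq I] (τ : ι → I)
    (σ : κ → I) (m : I) : count (Sum.elim τ σ) m = count τ m + count σ m := by
  simp only [count, Finset.card_filter, Fintype.sum_sum_type, Sum.elim_inl, Sum.elim_inr]
  rfl

theorem count_comp_equiv {ι κ I : Type*} [Fintype ι] [Fintype κ] [DecidableEq I] (e : ι ≃ κ)
    (σ : κ → I) (m : I) : count (σ ∘ e) m = count σ m := by
  simp only [count, Finset.card_filter, Function.comp]
  exact Equiv.sum_comp e fun b => if σ b = m then 1 else 0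

theorem count_unit {I : Type*} [DecidableEq I] (l m : I) :
    count (fun _ : Unit => l) m = if l = m then 1 else 0 := by
  simp only [count, Finset.card_filter, Finset.univ_unique, Finset.sum_singleton]

theorem count_sigma_fst {I : Type*} [Fintype I] [DecidableEq I] (n : I → ℕ) (m : I) :
    count (Sigma.fst : (Σ m, Fin (n m)) → I) m = n m := by
  rw [count, Finset.card_filter, Fintype.sum_sigma]
  simp [apply_ite Finset.card]

/-- A family of times is determined, up to a relabelling, by the numbers of its points at each
time. -/
theorem exists_equiv_sigma {ι I : Type*} [Fintype ι] [DecidableEq I] (τ : ι → I) :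
    ∃ e : (Σ m, Fin (count τ m)) ≃ ι, τ ∘ e = Sigma.fst := by
  have h : ∀ m, Fintype.card {a // τ a = m} = count τ m := fun m => Fintype.card_subtype _
  refine ⟨(Equiv.sigmaCongrRight fun m => (Fintype.equivFinOfCardEq (h m)).symm).trans
    (Equiv.sigmaFiberEquiv τ), ?_⟩
  funext a
  exact ((Fintype.equivFinOfCardEq (h a.1)).symm a.2).2

namespace ExtendedKernel

variable {I : Type*} [LinearOrder I] {N : ℕ} (E : ExtendedKernel I N)

theorem continuous_detK {ι : Type*} [Fintype ι] (τ : ι → I) : Continuous (E.detK τ) := by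
  classical
  simp only [funext fun x => E.detK_eq τ x]
  refine Continuous.matrix_det (continuous_matrix fun a b => ?_)
  have h : Continuous fun x : ι → ℝ => (x a, x b) :=
    (continuous_apply a).prodMk (continuous_apply b)
  exact (E.continuous_K (τ a) (τ b)).comp h

/-- The determinants are dominated by a product of integrable functions of the single points. -/
theorem abs_detK_le {ι : Type*} [Fintype ι] (τ : ι → I) (x : ι → ℝ) :
    |E.detK τ x| ≤ (Fintype.card ι).factorial * ∏ a, ((N * E.C + 1) * |E.g (x a)|) := by
  classical
  rw [detK_eq]
  exact abs_det_le_of_row_bound _ _ fun a b => E.abs_K_le _ _ _ _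

theorem integrable_prod_abs_g (ι : Type*) [Fintype ι] :
    Integrable fun x : ι → ℝ => ∏ a, ((N * E.C + 1) * |E.g (x a)|) :=
  Integrable.fintype_prod (f := fun _ z => (N * E.C + 1) * |E.g z|)
    fun _ => E.integrable_g.abs.const_mul _

theorem integrable_detK_sum_elim {ι κ : Type*} [Fintype ι] [Fintype κ] (τ : ι → I) (σ : κ → I)
    (x : ι → ℝ) : Integrable fun y : κ → ℝ => E.detK (Sum.elim τ σ) (Sum.elim x y) := by
  have hc : Continuous fun y : κ → ℝ => Sum.elim x y := continuous_pi fun a => by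
    rcases a with a | a
    · exact continuous_const
    · exact continuous_apply a
  refine ((E.integrable_prod_abs_g κ).const_mul ((Fintype.card (ι ⊕ κ)).factorial *
    ∏ a, ((N * E.C + 1) * |E.g (x a)|))).mono'
    ((E.continuous_detK _).comp hc).aestronglyMeasurable (ae_of_all _ fun y => ?_)
  have := E.abs_detK_le (Sum.elim τ σ) (Sum.elim x y)
  rw [Fintype.prod_sum_type] at this
  simpa [mul_assoc] using this

theorem integrable_prod_mul_detK {ι : Type*} [Fintype ι] (τ : ι → I) {ψ : ι → ℝ → ℝ} {B : ℝ}
    (hψ : ∀ a, Continuous (ψ a)) (hB : ∀ a z, |ψ a z| ≤ B) :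
    Integrable fun x : ι → ℝ => (∏ a, ψ a (x a)) * E.detK τ x := by
  refine Integrable.bdd_mul (c := ∏ _a : ι, B) ?_
    (continuous_finsetProd _ fun a _ => (hψ a).comp (continuous_apply a)).aestronglyMeasurable
    (ae_of_all _ fun x => ?_)
  · exact ((E.integrable_prod_abs_g ι).const_mul _).mono'
      (E.continuous_detK τ).aestronglyMeasurable (ae_of_all _ fun x => E.abs_detK_le τ x)
  · rw [Real.norm_eq_abs, Finset.abs_prod]
    exact Finset.prod_le_prod (fun _ _ => abs_nonneg _) fun a _ => hB _ _

/-- Integrating out the points indexed by `κ`, one after the other. Each of them contributes the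
factor `N` minus the number of points left at its time. -/
theorem integral_detK_sum_elim [Fintype I] {ι : Type*} [Fintype ι] (τ : ι → I) (x : ι → ℝ)
    (κ : Type*) [Fintype κ] (σ : κ → I) (h : ∀ m, count τ m + count σ m ≤ N) :
    ∫ y : κ → ℝ, E.detK (Sum.elim τ σ) (Sum.elim x y) =
      (∏ m, ((N - count τ m).descFactorial (count σ m) : ℝ)) * E.detK τ x := by
  revert σ
  refine Fintype.induction_empty_option (P := fun κ _ => ∀ σ : κ → I,
    (∀ m, count τ m + count σ m ≤ N) →
      ∫ y : κ → ℝ, E.detK (Sum.elim τ σ) (Sum.elim x y) =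
        (∏ m, ((N - count τ m).descFactorial (count σ m) : ℝ)) * E.detK τ x) ?_ ?_ ?_ κ
  · intro α β _ e ih σ h
    let _ := Fintype.ofEquiv β e.symm
    have h' : ∀ m, count (σ ∘ e) m = count σ m := count_comp_equiv e σ
    have := ih (σ ∘ e) fun m => by rw [h']; exact h m
    simp only [h'] at this
    rw [← this, ← integral_comp_equiv e]
    refine integral_congr_ae (ae_of_all _ fun y => ?_)
    simp only
    rw [← E.detK_comp_equiv (Equiv.sumCongr (Equiv.refl ι) e)]
    congr 1 <;> · funext a; rcases a with a | a <;> rfl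
  · intro σ h
    have h1 : ∀ m, count σ m = 0 := fun m => by simp [count]
    have h2 : ∀ y : PEmpty → ℝ, E.detK (Sum.elim τ σ) (Sum.elim x y) = E.detK τ x := fun y => by
      rw [← E.detK_comp_equiv (Equiv.sumEmpty ι PEmpty).symm]
      rfl
    simp only [h1, h2]
    simp [measureReal_def, volume_pi]
  · intro κ _ ih σ h
    obtain ⟨m, hm⟩ : ∃ m, σ none = m := ⟨_, rfl⟩
    let σ' : κ → I := fun a => σ (some a)
    let e : κ ⊕ Unit ≃ Option κ := (Equiv.optionEquivSumPUnit κ).symm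
    have hσ : σ ∘ e = Sum.elim σ' fun _ => m := by
      funext a
      rcases a with a | a
      · rfl
      · exact hm
    have hcount : ∀ l, count σ l = count σ' l + if m = l then 1 else 0 := fun l => by
      rw [← count_comp_equiv e, hσ, count_sum_elim, count_unit]
    have hint := E.integrable_detK_sum_elim τ (Sum.elim σ' fun _ : Unit => m) x
    calc ∫ y : Option κ → ℝ, E.detK (Sum.elim τ σ) (Sum.elim x y)
        = ∫ y : Option κ → ℝ, E.detK (Sum.elim τ (Sum.elim σ' fun _ : Unit => m))
            (Sum.elim x (y ∘ e)) := by
          refine integral_congr_ae (ae_of_all _ fun y => ?_)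
          simp only
          rw [← E.detK_comp_equiv (Equiv.sumCongr (Equiv.refl ι) e), ← hσ]
          congr 1 <;> · funext a; rcases a with a | a <;> rfl
      _ = ∫ y : κ → ℝ, ∫ z : ℝ, E.detK (Sum.elim τ (Sum.elim σ' fun _ : Unit => m))
            (Sum.elim x (Sum.elim y fun _ => z)) := by
          rw [integral_comp_equiv e fun y => E.detK (Sum.elim τ (Sum.elim σ' fun _ : Unit => m))
            (Sum.elim x y), integral_sum_elim hint]
          simp only [integral_unit_pi]
      _ = ∫ y : κ → ℝ, (N - (count τ m + count σ' m : ℕ) : ℝ) *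
            E.detK (Sum.elim τ σ') (Sum.elim x y) := by
          refine integral_congr_ae (ae_of_all _ fun y => ?_)
          simp only
          rw [← count_sum_elim, count, ← E.integral_detK_sum_unit]
          refine integral_congr_ae (ae_of_all _ fun z => ?_)
          simp only
          rw [← E.detK_comp_equiv (Equiv.sumAssoc ι κ Unit)]
          congr 1 <;> · funext a; rcases a with (a | a) | a <;> rfl
      _ = _ := by
          rw [integral_const_mul, ih σ' fun l => by have := h l; rw [hcount] at this; omega,
            ← mul_assoc]
          congr 1
          rw [← Finset.mul_prod_erase _ _ (Finset.mem_univ m),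
            ← Finset.mul_prod_erase _ _ (Finset.mem_univ m), ← mul_assoc]
          congr 1
          · have := h m
            rw [hcount] at this ⊢
            simp only [if_true] at this ⊢
            rw [Nat.descFactorial_succ, Nat.sub_sub, Nat.cast_mul, Nat.cast_sub (by omega)]
          · refine Finset.prod_congr rfl fun l hl => ?_
            rw [hcount, if_neg (Finset.ne_of_mem_erase hl).symm, add_zero]

/-- The integral of `detK` at the points of `ι`, with weights `ψ m` at the points at time `m`. -/
noncomputable def weightedIntegral {ι : Type*} [Fintype ι] (τ : ι → I) (ψ : I → ℝ → ℝ) : ℝ :=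
  ∫ x : ι → ℝ, (∏ a, ψ (τ a) (x a)) * E.detK τ x

theorem weightedIntegral_comp_equiv {ι κ : Type*} [Fintype ι] [Fintype κ] (e : ι ≃ κ) (τ : κ → I)
    (ψ : I → ℝ → ℝ) : E.weightedIntegral (τ ∘ e) ψ = E.weightedIntegral τ ψ := by
  unfold weightedIntegral
  rw [← integral_comp_equiv e]
  refine integral_congr_ae (ae_of_all _ fun x => ?_)
  simp only
  rw [E.detK_comp_equiv, ← Equiv.prod_comp e]
  rfl

/-- If the weights are put on the points with property `p` only, and there are `N` points at each time, then
the other points can be integrated out. -/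
theorem integral_prod_subset_mul_detK [Fintype I] {ι : Type*} [Fintype ι] (τ : ι → I)
    (hτ : ∀ m, count τ m = N) (p : ι → Prop) [DecidablePred p] {ψ : I → ℝ → ℝ} {B : ℝ}
    (hψ : ∀ m, Continuous (ψ m)) (hB : ∀ m z, |ψ m z| ≤ B) :
    ∫ x : ι → ℝ, (∏ a, if p a then ψ (τ a) (x a) else 1) * E.detK τ x =
      (∏ m, ((N - count (fun a : {a // p a} => τ a) m).factorial : ℝ)) *
        E.weightedIntegral (fun a : {a // p a} => τ a) ψ := by
  classical
  set τ₁ : {a // p a} → I := fun a => τ a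
  set τ₂ : {a // ¬p a} → I := fun a => τ a
  let e : {a // p a} ⊕ {a // ¬p a} ≃ ι := Equiv.sumCompl p
  have hτe : τ ∘ e = Sum.elim τ₁ τ₂ := by
    funext a
    rcases a with a | a <;> rfl
  have hcount : ∀ m, count τ₁ m + count τ₂ m = N := fun m => by
    rw [← count_sum_elim, ← hτe, count_comp_equiv, hτ]
  have hint := E.integrable_prod_mul_detK (Sum.elim τ₁ τ₂)
    (ψ := Sum.elim (fun a => ψ (τ₁ a)) fun _ _ => 1) (B := max B 1)
    (fun a => by
      rcases a with a | a
      · exact hψ _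
      · exact continuous_const)
    (fun a z => by
      rcases a with a | a
      · exact (hB _ _).trans (le_max_left _ _)
      · simp)
  calc ∫ x : ι → ℝ, (∏ a, if p a then ψ (τ a) (x a) else 1) * E.detK τ x
      = ∫ x : ι → ℝ, (∏ a, (Sum.elim (fun a => ψ (τ₁ a)) fun _ _ => 1 :
          {a // p a} ⊕ {a // ¬p a} → ℝ → ℝ) a ((x ∘ e) a)) * E.detK (Sum.elim τ₁ τ₂) (x ∘ e) := by
        refine integral_congr_ae (ae_of_all _ fun x => ?_)
        simp only
        rw [← hτe, E.detK_comp_equiv, ← Equiv.prod_comp e]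
        congr 1
        refine Finset.prod_congr rfl fun a _ => ?_
        rcases a with a | a
        · simp [e, a.2, τ₁]
        · simp [e, a.2]
    _ = ∫ x : {a // p a} → ℝ, ∫ y : {a // ¬p a} → ℝ, (∏ a, ψ (τ₁ a) (x a)) *
          E.detK (Sum.elim τ₁ τ₂) (Sum.elim x y) := by
        rw [integral_comp_equiv e fun x => (∏ a, (Sum.elim (fun a => ψ (τ₁ a)) fun _ _ => 1 :
          {a // p a} ⊕ {a // ¬p a} → ℝ → ℝ) a (x a)) * E.detK (Sum.elim τ₁ τ₂) x,
          integral_sum_elim hint]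
        simp [Fintype.prod_sum_type]
    _ = _ := by
        rw [weightedIntegral, ← integral_const_mul]
        refine integral_congr_ae (ae_of_all _ fun x => ?_)
        simp only
        rw [integral_const_mul, E.integral_detK_sum_elim τ₁ x _ τ₂ fun m => (hcount m).le]
        have : ∀ m, (N - count τ₁ m).descFactorial (count τ₂ m) =
            (N - count τ₁ m).factorial := fun m => by
          rw [← Nat.descFactorial_self]
          congr 1
          have := hcount m
          omega
        simp only [this]
        ring

end ExtendedKernel

theorem count_subtype_sigma {I : Type*} [Fintype I] [DecidableEq I] {N : ℕ}
    (S : I → Finset (Fin N)) (m : I) :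
    count (fun a : {a : Σ _ : I, Fin N // a.2 ∈ S a.1} => a.1.1) m = (S m).card := by
  unfold count
  refine (Finset.card_bij (fun j hj => ⟨⟨m, j⟩, hj⟩) (fun j hj => ?_) (fun i _ j _ h => ?_)
    fun a ha => ?_).symm
  · simp
  · simpa using h
  · obtain ⟨⟨l, j⟩, hj⟩ := a
    obtain rfl : l = m := by simpa using ha
    exact ⟨j, hj, rfl⟩

/-- A sum over families of subsets of `Fin N` of a function of their cardinalities. -/
theorem sum_finset_family_card {I : Type*} [Fintype I] [DecidableEq I] {N : ℕ}
    (F : (I → ℕ) → ℝ) :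
    ∑ S ∈ Fintype.piFinset (fun _ : I => (Finset.univ : Finset (Fin N)).powerset),
        F (fun m => (S m).card) =
      ∑ n ∈ Fintype.piFinset (fun _ : I => Finset.range (N + 1)),
        (∏ m, (N.choose (n m) : ℝ)) * F n := by
  have hmaps : ∀ S ∈ Fintype.piFinset (fun _ : I => (Finset.univ : Finset (Fin N)).powerset),
      (fun m => (S m).card) ∈ Fintype.piFinset (fun _ : I => Finset.range (N + 1)) := by
    intro S _
    rw [Fintype.mem_piFinset]
    intro m
    have := Finset.card_le_univ (S m)
    rw [Fintype.card_fin] at this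
    rw [Finset.mem_range]
    omega
  rw [← Finset.sum_fiberwise_of_maps_to hmaps]
  refine Finset.sum_congr rfl fun n _ => ?_
  have h1 : ∀ S ∈ (Fintype.piFinset
      (fun _ : I => (Finset.univ : Finset (Fin N)).powerset)).filter
        (fun S => (fun m => (S m).card) = n), F (fun m => (S m).card) = F n := fun S hS => by
    rw [(Finset.mem_filter.1 hS).2]
  rw [Finset.sum_congr rfl h1, Finset.sum_const, nsmul_eq_mul]
  congr 1
  have h2 : (Fintype.piFinset
      (fun _ : I => (Finset.univ : Finset (Fin N)).powerset)).filter
        (fun S => (fun m => (S m).card) = n) =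
      Fintype.piFinset fun m => Finset.powersetCard (n m) (Finset.univ : Finset (Fin N)) := by
    ext S
    simp [Fintype.mem_piFinset, Finset.mem_powersetCard, funext_iff]
  rw [h2, Fintype.card_piFinset]
  simp [Finset.card_powersetCard]

namespace ExtendedKernel

variable {I : Type*} [LinearOrder I] {N : ℕ} (E : ExtendedKernel I N)

theorem weightedIntegral_eq_of_count [Fintype I] {ι : Type*} [Fintype ι] (τ : ι → I)
    (ψ : I → ℝ → ℝ) {n : I → ℕ} (h : ∀ m, count τ m = n m) :
    E.weightedIntegral τ ψ = E.weightedIntegral (Sigma.fst : (Σ m, Fin (n m)) → I) ψ := by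
  obtain rfl : count τ = n := funext h
  obtain ⟨e, he⟩ := exists_equiv_sigma τ
  rw [← E.weightedIntegral_comp_equiv e, he]

theorem weightedIntegral_eq_zero [Fintype I] (ψ : I → ℝ → ℝ) {n : I → ℕ} {m : I} (h : N < n m) :
    E.weightedIntegral (Sigma.fst : (Σ m, Fin (n m)) → I) ψ = 0 := by
  unfold weightedIntegral
  have : ∀ x, E.detK (Sigma.fst : (Σ m, Fin (n m)) → I) x = 0 := fun x => by
    refine E.detK_eq_zero _ m x ?_
    have := count_sigma_fst n m
    rw [count] at this
    rwa [this]
  simp [this]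

/-- Expansion of the generating function of `N` points at each time: the product of the `1 + ψ` is
expanded into a sum over subsets of the points, and the other points are integrated out. -/
theorem integral_prod_one_add_mul_detK [Fintype I] {ψ : I → ℝ → ℝ} {B : ℝ}
    (hψ : ∀ m, Continuous (ψ m)) (hB : ∀ m z, |ψ m z| ≤ B) :
    ∫ x : (Σ _ : I, Fin N) → ℝ, (∏ a, (1 + ψ a.1 (x a))) *
        E.detK (Sigma.fst : (Σ _ : I, Fin N) → I) x =
      (N.factorial : ℝ) ^ Fintype.card I *
        ∑ n ∈ Fintype.piFinset (fun _ : I => Finset.range (N + 1)),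
          (∏ m, (1 / ((n m).factorial : ℝ))) *
            E.weightedIntegral (Sigma.fst : (Σ m, Fin (n m)) → I) ψ := by
  have hexp : ∀ x : (Σ _ : I, Fin N) → ℝ, ∏ a, (1 + ψ a.1 (x a)) =
      ∑ S ∈ Fintype.piFinset (fun _ : I => (Finset.univ : Finset (Fin N)).powerset),
        ∏ a : Σ _ : I, Fin N, if a.2 ∈ S a.1 then ψ a.1 (x a) else 1 := fun x => by
    rw [Fintype.prod_sigma]
    simp only [Finset.prod_one_add]
    rw [Finset.prod_univ_sum]
    refine Finset.sum_congr rfl fun S _ => ?_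
    rw [Fintype.prod_sigma]
    refine Finset.prod_congr rfl fun m _ => ?_
    simp only
    rw [Finset.prod_ite_mem, Finset.univ_inter]
  have hint : ∀ S : I → Finset (Fin N), Integrable fun x : (Σ _ : I, Fin N) → ℝ =>
      (∏ a : Σ _ : I, Fin N, if a.2 ∈ S a.1 then ψ a.1 (x a) else 1) *
        E.detK (Sigma.fst : (Σ _ : I, Fin N) → I) x := fun S => by
    have hc : ∀ a : Σ _ : I, Fin N, Continuous fun z => if a.2 ∈ S a.1 then ψ a.1 z else 1 :=
      fun a => by
        split_ifs
        · exact hψ _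
        · exact continuous_const
    have hb : ∀ (a : Σ _ : I, Fin N) (z : ℝ), |if a.2 ∈ S a.1 then ψ a.1 z else 1| ≤ max B 1 :=
      fun a z => by
        split_ifs
        · exact (hB _ _).trans (le_max_left _ _)
        · simp
    exact E.integrable_prod_mul_detK (Sigma.fst : (Σ _ : I, Fin N) → I) hc hb
  simp only [hexp, Finset.sum_mul]
  rw [integral_finsetSum _ fun S _ => hint S]
  let F : (I → ℕ) → ℝ := fun n => (∏ m, ((N - n m).factorial : ℝ)) *
    E.weightedIntegral (Sigma.fst : (Σ m, Fin (n m)) → I) ψ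
  have hS : ∀ S : I → Finset (Fin N), ∫ x : (Σ _ : I, Fin N) → ℝ,
      (∏ a : Σ _ : I, Fin N, if a.2 ∈ S a.1 then ψ a.1 (x a) else 1) *
        E.detK (Sigma.fst : (Σ _ : I, Fin N) → I) x =
      F fun m => (S m).card := fun S => by
    have hc := count_subtype_sigma S
    rw [E.integral_prod_subset_mul_detK (Sigma.fst : (Σ _ : I, Fin N) → I)
      (count_sigma_fst fun _ => N) (fun a => a.2 ∈ S a.1) hψ hB,
      E.weightedIntegral_eq_of_count _ ψ hc]
    simp only [hc, F]
  rw [Finset.sum_congr rfl fun S _ => hS S, sum_finset_family_card F, Finset.mul_sum]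
  refine Finset.sum_congr rfl fun n hn => ?_
  simp only [F]
  rw [← mul_assoc, ← mul_assoc, ← Finset.prod_mul_distrib]
  congr 1
  rw [← Finset.card_univ, ← Finset.prod_const, ← Finset.prod_mul_distrib]
  refine Finset.prod_congr rfl fun m _ => ?_
  have hm : n m ≤ N := Nat.lt_succ_iff.1 (Finset.mem_range.1 (Fintype.mem_piFinset.1 hn m))
  have h0 : ((n m).factorial : ℝ) ≠ 0 := by positivity
  rw [← Nat.choose_mul_factorial_mul_factorial hm]
  push_cast
  field_simp

end ExtendedKernel

/-! ### The determinant at full configurations -/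

/-- The determinant of a block lower triangular matrix whose blocks all have size `N`. -/
theorem det_prod_of_lowerTriangular {R : Type*} [CommRing R] {L N : ℕ}
    (G : Matrix (Fin L × Fin N) (Fin L × Fin N) R)
    (h : ∀ a b : Fin L × Fin N, a.1 < b.1 → G a b = 0) :
    G.det = ∏ i, (Matrix.of fun j k : Fin N => G (i, j) (i, k)).det := by
  have hG : G.transpose.BlockTriangular Prod.fst := fun a b hab => h _ _ hab
  rw [← Matrix.det_transpose, hG.det_fintype]
  refine Finset.prod_congr rfl fun i _ => ?_
  let e : Fin N ≃ {a : Fin L × Fin N // a.1 = i} :=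
    { toFun := fun j => ⟨(i, j), rfl⟩
      invFun := fun a => a.1.2
      left_inv := fun _ => rfl
      right_inv := fun ⟨⟨l, j⟩, hl⟩ => by cases hl; rfl }
  rw [← Matrix.det_submatrix_equiv_self e, ← Matrix.det_transpose]
  rfl

namespace ExtendedKernel

variable {M N : ℕ} (E : ExtendedKernel (Fin (M + 1)) N)

/-- At `N` points for each time the determinant factorizes. It is the Schur complement of a matrix
with one more block of size `N`, which is block lower triangular up to a cyclic shift of its block
columns. The sign of the shift is cancelled by the signs of the diagonal blocks. -/
theorem detK_full (x : Fin (M + 1) → Fin N → ℝ) :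
    E.detK (Sigma.fst : (Σ _ : Fin (M + 1), Fin N) → Fin (M + 1)) (fun a => x a.1 a.2) =
      (Matrix.of fun j k => E.Q 0 k (x 0 j)).det *
        (∏ m : Fin M, (Matrix.of fun j k =>
          E.T m.succ m.castSucc (x m.succ j) (x m.castSucc k)).det) *
        (Matrix.of fun k j => E.P (Fin.last M) k (x (Fin.last M) j)).det := by
  let Qm : Matrix (Fin (M + 1) × Fin N) (Fin N) ℝ := Matrix.of fun a k => E.Q a.1 k (x a.1 a.2)
  let Pm : Matrix (Fin N) (Fin (M + 1) × Fin N) ℝ := Matrix.of fun k a => E.P a.1 k (x a.1 a.2)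
  let Tm : Matrix (Fin (M + 1) × Fin N) (Fin (M + 1) × Fin N) ℝ := Matrix.of fun a b =>
    if b.1 < a.1 then E.T a.1 b.1 (x a.1 a.2) (x b.1 b.2) else 0
  let A : Matrix (Fin N ⊕ Fin (M + 1) × Fin N) (Fin N ⊕ Fin (M + 1) × Fin N) ℝ :=
    Matrix.fromBlocks 1 (-Pm) Qm (-Tm)
  have h1 : E.detK (Sigma.fst : (Σ _ : Fin (M + 1), Fin N) → Fin (M + 1))
      (fun a => x a.1 a.2) = A.det := by
    rw [Matrix.det_fromBlocks_one₁₁, detK_eq,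
      ← Matrix.det_submatrix_equiv_self (Equiv.sigmaEquivProd (Fin (M + 1)) (Fin N)).symm]
    congr 1
    ext a b
    simp only [kernelMat, K, Matrix.submatrix_apply, Matrix.of_apply, Matrix.sub_apply,
      Matrix.neg_apply, Matrix.mul_apply, Qm, Pm, Tm, mul_neg, Finset.sum_neg_distrib,
      sub_neg_eq_add, Equiv.sigmaEquivProd_symm_apply]
    ring
  -- Rows: the times in order, then the additional block. Columns: the additional block first.
  let G : Matrix (Fin (M + 2) × Fin N) (Fin (M + 2) × Fin N) ℝ := Matrix.of fun a b =>
    (Fin.lastCases (motive := fun _ => ℝ)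
      (Fin.cases (motive := fun _ => ℝ) ((1 : Matrix (Fin N) (Fin N) ℝ) a.2 b.2)
        (fun n => -Pm a.2 (n, b.2)) b.1)
      (fun m => Fin.cases (motive := fun _ => ℝ) (Qm (m, a.2) b.2)
        (fun n => -Tm (m, a.2) (n, b.2)) b.1) a.1)
  have h2 : G.det = (∏ m : Fin M, (Matrix.of fun j k =>
        -E.T m.succ m.castSucc (x m.succ j) (x m.castSucc k)).det) *
      (Matrix.of fun j k => E.Q 0 k (x 0 j)).det *
      (Matrix.of fun k j => -E.P (Fin.last M) k (x (Fin.last M) j)).det := by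
    rw [det_prod_of_lowerTriangular G, Fin.prod_univ_castSucc, Fin.prod_univ_succ,
      mul_comm (Matrix.det _) (∏ _, _)]
    · congr 1
      · congr 1
        · refine Finset.prod_congr rfl fun m _ => ?_
          congr 1
          ext j k
          simp only [G, Matrix.of_apply, Fin.lastCases_castSucc]
          rw [← Fin.succ_castSucc, Fin.cases_succ]
          simp [Tm]
        · congr 1
          ext j k
          simp only [G, Matrix.of_apply, Fin.lastCases_castSucc]
          rw [Fin.castSucc_zero, Fin.cases_zero]
          rfl
      · congr 1
        ext j k
        simp only [G, Matrix.of_apply, Fin.lastCases_last]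
        rw [← Fin.succ_last, Fin.cases_succ]
        rfl
    · rintro ⟨a, j⟩ ⟨b, k⟩ hab
      simp only at hab
      induction a using Fin.lastCases with
      | last => exact absurd hab (Fin.le_last b).not_gt
      | cast m =>
        induction b using Fin.cases with
        | zero => exact absurd hab (Fin.zero_le _).not_gt
        | succ n =>
          have hmn : ¬ n < m := by
            rw [Fin.lt_def] at hab ⊢
            simp at hab
            omega
          simp [G, Tm, hmn]
  let e : Fin N ⊕ Fin (M + 1) × Fin N ≃ Fin (M + 2) × Fin N :=
    { toFun := Sum.elim (fun k => (0, k)) fun a => (a.1.succ, a.2)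
      invFun := fun a => Fin.cases (motive := fun _ => Fin N ⊕ Fin (M + 1) × Fin N)
        (Sum.inl a.2) (fun m => Sum.inr (m, a.2)) a.1
      left_inv := fun a => by rcases a with a | a <;> rfl
      right_inv := fun ⟨a, k⟩ => by induction a using Fin.cases <;> rfl }
  let ρ : Equiv.Perm (Fin (M + 2) × Fin N) := Equiv.prodCongrLeft fun _ => finRotate (M + 2)
  have h3 : A.submatrix e.symm e.symm = G.submatrix ρ.symm id := by
    have h : (A.submatrix e.symm e.symm).submatrix ρ id = G := by
      ext ⟨a, j⟩ ⟨b, k⟩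
      induction a using Fin.lastCases with
      | last =>
        have : ρ (Fin.last (M + 1), j) = (0, j) := by
          simp [ρ, Equiv.prodCongrLeft]
        simp only [Matrix.submatrix_apply, this]
        induction b using Fin.cases with
        | zero => simp [e, A, G]
        | succ n => simp [e, A, G]
      | cast m =>
        have : ρ (m.castSucc, j) = (m.succ, j) := by
          simp [ρ, Equiv.prodCongrLeft]
        simp only [Matrix.submatrix_apply, this]
        induction b using Fin.cases with
        | zero => simp [e, A, G]
        | succ n => simp [e, A, G]
    rw [← h]
    ext a b
    simp
  have h4 : A.det = ((-1) ^ (M + 1)) ^ N * G.det := by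
    rw [← Matrix.det_submatrix_equiv_self e.symm, h3, Matrix.det_permute]
    simp [ρ, Equiv.Perm.sign_prodCongrLeft]
  rw [h1, h4, h2]
  have hneg : ∀ B : Fin N → Fin N → ℝ,
      (Matrix.of fun j k => -B j k).det = (-1) ^ N * (Matrix.of B).det := fun B => by
    have : (Matrix.of fun j k => -B j k) = -Matrix.of B := rfl
    rw [this, Matrix.det_neg, Fintype.card_fin]
  simp only [hneg, Finset.prod_mul_distrib, Finset.prod_const, Finset.card_univ, Fintype.card_fin]
  have hs : (((-1 : ℝ) ^ (M + 1)) ^ N) * (((-1) ^ N) ^ M * (-1) ^ N) = 1 := by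
    rw [← pow_succ, ← pow_mul, ← pow_mul, mul_comm N, ← pow_add, Even.neg_one_pow ⟨_, rfl⟩]
  linear_combination ((∏ m : Fin M, (Matrix.of fun j k =>
          E.T m.succ m.castSucc (x m.succ j) (x m.castSucc k)).det) *
      (Matrix.of fun j k => E.Q 0 k (x 0 j)).det *
      (Matrix.of fun k j => E.P (Fin.last M) k (x (Fin.last M) j)).det) * hs

end ExtendedKernel

/-! ### Hermite polynomials -/

/-- The derivatives of a solution of `F' = (a + 2 b w) F` satisfy the three term recurrence of the
Hermite polynomials. -/
theorem iteratedDeriv_of_deriv_eq_affine_mul {𝕜 : Type*} [NontriviallyNormedField 𝕜] {F : 𝕜 → 𝕜}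
    (hF : ∀ n : ℕ, ContDiff 𝕜 n F) (a b : 𝕜) (h : ∀ w, deriv F w = (a + 2 * b * w) * F w)
    (k : ℕ) (w : 𝕜) :
    iteratedDeriv (k + 2) F w = (a + 2 * b * w) * iteratedDeriv (k + 1) F w +
      2 * b * (k + 1) * iteratedDeriv k F w := by
  have hd : ∀ k w, HasDerivAt (iteratedDeriv k F) (iteratedDeriv (k + 1) F w) w := fun k w => by
    rw [iteratedDeriv_succ]
    exact (((hF (k + 1)).differentiable_iteratedDeriv k
      (by exact_mod_cast Nat.lt_succ_self k)) w).hasDerivAt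
  have hl : ∀ w, HasDerivAt (fun w => a + 2 * b * w) (2 * b) w := fun w => by
    simpa using ((hasDerivAt_id w).const_mul (2 * b)).const_add a
  induction k generalizing w with
  | zero =>
    have h1 : iteratedDeriv 1 F = fun w => (a + 2 * b * w) * F w := by
      rw [iteratedDeriv_one]
      exact funext h
    have h0 := hd 0 w
    rw [iteratedDeriv_zero] at h0
    rw [iteratedDeriv_succ, zero_add, h1]
    refine ((hl w).mul h0).deriv.trans ?_
    rw [zero_add, h1, iteratedDeriv_zero]
    push_cast
    ring
  | succ k ih =>
    rw [iteratedDeriv_succ, funext ih]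
    refine (((hl w).mul (hd (k + 1) w)).add ((hd k w).const_mul (2 * b * (k + 1)))).deriv.trans ?_
    rw [ih]
    push_cast
    ring

theorem contDiff_exp_neg_sq (n : ℕ) : ContDiff ℝ n fun y : ℝ => Real.exp (-y ^ 2) := by
  fun_prop

theorem deriv_exp_neg_sq (w : ℝ) :
    deriv (fun y : ℝ => Real.exp (-y ^ 2)) w = (0 + 2 * (-1) * w) * Real.exp (-w ^ 2) := by
  have : HasDerivAt (fun y : ℝ => Real.exp (-y ^ 2)) (Real.exp (-w ^ 2) * (-(2 * w))) w := by
    simpa using ((hasDerivAt_pow 2 w).neg).exp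
  rw [this.deriv]
  ring

theorem hermiteH_zero (x : ℝ) : hermiteH 0 x = 1 := by
  simp [hermiteH, ← Real.exp_add]

theorem hermiteH_one (x : ℝ) : hermiteH 1 x = 2 * x := by
  have h : Real.exp (x ^ 2) * Real.exp (-x ^ 2) = 1 := by simp [← Real.exp_add]
  rw [hermiteH, iteratedDeriv_one, deriv_exp_neg_sq]
  linear_combination (2 * x) * h

theorem hermiteH_add_two (k : ℕ) (x : ℝ) :
    hermiteH (k + 2) x = 2 * x * hermiteH (k + 1) x - 2 * (k + 1) * hermiteH k x := by
  simp only [hermiteH]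
  rw [iteratedDeriv_of_deriv_eq_affine_mul contDiff_exp_neg_sq 0 (-1) deriv_exp_neg_sq]
  ring

theorem hasDerivAt_hermiteH (k : ℕ) (x : ℝ) :
    HasDerivAt (hermiteH k) (2 * x * hermiteH k x - hermiteH (k + 1) x) x := by
  have h1 : HasDerivAt (iteratedDeriv k fun y : ℝ => Real.exp (-y ^ 2))
      (iteratedDeriv (k + 1) (fun y : ℝ => Real.exp (-y ^ 2)) x) x := by
    rw [iteratedDeriv_succ]
    exact (((contDiff_exp_neg_sq (k + 1)).differentiable_iteratedDeriv k
      (by exact_mod_cast Nat.lt_succ_self k)) x).hasDerivAt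
  have h2 : HasDerivAt (fun y : ℝ => Real.exp (y ^ 2)) (Real.exp (x ^ 2) * (2 * x)) x := by
    simpa using (hasDerivAt_pow 2 x).exp
  refine (h2.mul (h1.const_mul ((-1) ^ k))).congr_deriv ?_
  simp only [hermiteH]
  ring

theorem continuous_hermiteH (k : ℕ) : Continuous (hermiteH k) :=
  continuous_iff_continuousAt.2 fun x => (hasDerivAt_hermiteH k x).continuousAt

/-- The coefficients of the generating function `exp (2 |y| w + w ^ 2)`, which dominate those of
`exp (2 y w - w ^ 2)`. -/
def hermiteMajorant (y : ℝ) : ℕ → ℝ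
  | 0 => 1
  | 1 => 2 * |y|
  | k + 2 => 2 * |y| * hermiteMajorant y (k + 1) + 2 * (k + 1) * hermiteMajorant y k

theorem hermiteMajorant_nonneg (y : ℝ) : ∀ k, 0 ≤ hermiteMajorant y k
  | 0 => zero_le_one
  | 1 => by unfold hermiteMajorant; positivity
  | k + 2 => by
    have h1 := hermiteMajorant_nonneg y (k + 1)
    have h2 := hermiteMajorant_nonneg y k
    unfold hermiteMajorant
    positivity

theorem abs_hermiteH_le (y : ℝ) : ∀ k, |hermiteH k y| ≤ hermiteMajorant y k
  | 0 => by simp [hermiteH_zero, hermiteMajorant]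
  | 1 => by simp [hermiteH_one, hermiteMajorant, abs_mul]
  | k + 2 => by
    have h1 := abs_hermiteH_le y (k + 1)
    have h2 := abs_hermiteH_le y k
    rw [hermiteH_add_two, hermiteMajorant]
    refine (abs_sub _ _).trans ?_
    rw [abs_mul, abs_mul, abs_mul, abs_mul, abs_two, abs_of_nonneg (by positivity : (0:ℝ) ≤ k + 1)]
    gcongr

/-- Taylor expansion of `exp (a w + b w ^ 2)`, with the coefficients determined by their
recurrence. -/
theorem hasSum_exp_quadratic (a b : ℂ) (c : ℕ → ℂ) (h0 : c 0 = 1) (h1 : c 1 = a)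
    (h2 : ∀ k, c (k + 2) = a * c (k + 1) + 2 * b * (k + 1) * c k) (w : ℂ) :
    HasSum (fun k => c k * w ^ k / k.factorial) (Complex.exp (a * w + b * w ^ 2)) := by
  set F : ℂ → ℂ := fun w => Complex.exp (a * w + b * w ^ 2) with hF
  have hC : ∀ n : ℕ, ContDiff ℂ n F := fun n => by fun_prop
  have hd : ∀ w, deriv F w = (a + 2 * b * w) * F w := fun w => by
    have : HasDerivAt F (Complex.exp (a * w + b * w ^ 2) * (a * 1 + b * (2 * w))) w := by
      simpa using (((hasDerivAt_id w).const_mul a).add ((hasDerivAt_pow 2 w).const_mul b)).cexp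
    rw [this.deriv]
    simp only [hF]
    ring
  -- Both sequences satisfy the same three term recurrence, so two terms are carried along.
  have hk : ∀ k, iteratedDeriv k F 0 = c k ∧ iteratedDeriv (k + 1) F 0 = c (k + 1) := by
    intro k
    induction k with
    | zero =>
      refine ⟨by simp [h0, hF], ?_⟩
      rw [zero_add, iteratedDeriv_one, hd, h1]
      simp [hF]
    | succ k ih =>
      refine ⟨ih.2, ?_⟩
      rw [iteratedDeriv_of_deriv_eq_affine_mul hC a b hd, ih.1, ih.2, h2]
      ring
  have := Complex.hasSum_taylorSeries_of_entire ((hC 1).differentiable (by simp)) 0 w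
  convert! this using 2 with k
  rw [(hk k).1, sub_zero, smul_eq_mul, smul_eq_mul]
  ring

/-- The generating function of the Hermite polynomials. -/
theorem hasSum_hermiteH (y : ℝ) (w : ℂ) :
    HasSum (fun k => (hermiteH k y : ℂ) * w ^ k / k.factorial)
      (Complex.exp (2 * y * w - w ^ 2)) := by
  have := hasSum_exp_quadratic (2 * y) (-1) (fun k => (hermiteH k y : ℂ))
    (by simp [hermiteH_zero]) (by simp [hermiteH_one])
    (fun k => by rw [hermiteH_add_two]; push_cast; ring) w
  rwa [neg_one_mul, ← sub_eq_add_neg] at this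

theorem hasSum_hermiteMajorant (y w : ℝ) :
    HasSum (fun k => hermiteMajorant y k * w ^ k / k.factorial)
      (Real.exp (2 * |y| * w + w ^ 2)) := by
  have := hasSum_exp_quadratic (2 * |y| : ℝ) 1 (fun k => (hermiteMajorant y k : ℂ))
    (by simp [hermiteMajorant]) (by simp [hermiteMajorant])
    (fun k => by simp [hermiteMajorant]) w
  rw [← Complex.hasSum_ofReal]
  push_cast at this ⊢
  simpa using this

theorem hermiteMajorant_le (y : ℝ) (k : ℕ) :
    hermiteMajorant y k ≤ k.factorial * Real.exp (2 * |y| + 1) := by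
  have h := le_hasSum (hasSum_hermiteMajorant y 1) k fun j _ => by
    have := hermiteMajorant_nonneg y j
    positivity
  simp only [one_pow, mul_one] at h
  rwa [div_le_iff₀ (by positivity), mul_comm] at h

/-! ### Hermite functions -/

theorem continuous_hermiteFun (k : ℕ) : Continuous (hermiteFun k) := by
  unfold hermiteFun
  exact (by fun_prop : Continuous fun x : ℝ =>
    1 / Real.sqrt (Real.sqrt Real.pi * 2 ^ k * (k.factorial : ℝ)) * Real.exp (-x ^ 2 / 2)).mul
      (continuous_hermiteH k)

theorem exists_abs_hermiteFun_le (k : ℕ) :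
    ∃ C, ∀ x, |hermiteFun k x| ≤ C * Real.exp (-x ^ 2 / 4) := by
  obtain ⟨c, hc⟩ : ∃ c, c = 1 / Real.sqrt (Real.sqrt Real.pi * 2 ^ k * (k.factorial : ℝ)) :=
    ⟨_, rfl⟩
  have hc0 : 0 ≤ c := by rw [hc]; positivity
  refine ⟨c * (k.factorial * Real.exp 5), fun x => ?_⟩
  have h : |hermiteH k x| ≤ k.factorial * Real.exp (2 * |x| + 1) :=
    (abs_hermiteH_le x k).trans (hermiteMajorant_le x k)
  have h2 : Real.exp (-x ^ 2 / 2) * Real.exp (2 * |x| + 1) ≤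
      Real.exp 5 * Real.exp (-x ^ 2 / 4) := by
    rw [← Real.exp_add, ← Real.exp_add, Real.exp_le_exp]
    nlinarith [sq_nonneg (|x| - 4), sq_abs x]
  rw [hermiteFun, ← hc, abs_mul, abs_mul, abs_of_nonneg hc0, Real.abs_exp, mul_assoc, mul_assoc]
  refine mul_le_mul_of_nonneg_left ?_ hc0
  calc Real.exp (-x ^ 2 / 2) * |hermiteH k x|
      ≤ Real.exp (-x ^ 2 / 2) * (k.factorial * Real.exp (2 * |x| + 1)) := by gcongr
    _ = k.factorial * (Real.exp (-x ^ 2 / 2) * Real.exp (2 * |x| + 1)) := by ring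
    _ ≤ k.factorial * (Real.exp 5 * Real.exp (-x ^ 2 / 4)) := by gcongr
    _ = _ := by ring

theorem integrable_of_abs_le_exp {f : ℝ → ℝ} (hf : Continuous f) {C b : ℝ} (hb : 0 < b)
    (h : ∀ x, |f x| ≤ C * Real.exp (-b * x ^ 2)) : Integrable f :=
  ((integrable_exp_neg_mul_sq hb).const_mul C).mono' hf.aestronglyMeasurable (ae_of_all _ h)

theorem integrable_hermiteFun_mul (j k : ℕ) :
    Integrable fun x => hermiteFun j x * hermiteFun k x := by
  obtain ⟨C, hC⟩ := exists_abs_hermiteFun_le j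
  obtain ⟨D, hD⟩ := exists_abs_hermiteFun_le k
  refine integrable_of_abs_le_exp ((continuous_hermiteFun j).mul (continuous_hermiteFun k))
    (C := C * D) (b := 1 / 2) (by norm_num) fun x => ?_
  rw [abs_mul]
  refine (mul_le_mul (hC x) (hD x) (abs_nonneg _) ((abs_nonneg _).trans (hC x))).trans_eq ?_
  have : Real.exp (-(1 / 2) * x ^ 2) = Real.exp (-x ^ 2 / 4) * Real.exp (-x ^ 2 / 4) := by
    rw [← Real.exp_add]
    ring_nf
  rw [this]
  ring

theorem hermiteFun_mul_hermiteFun (j k : ℕ) (x y : ℝ) :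
    hermiteFun j x * hermiteFun k y = (1 / Real.sqrt (Real.sqrt Real.pi * 2 ^ j * j.factorial) *
      (1 / Real.sqrt (Real.sqrt Real.pi * 2 ^ k * k.factorial))) *
        (hermiteH j x * hermiteH k y * (Real.exp (-x ^ 2 / 2) * Real.exp (-y ^ 2 / 2))) := by
  simp only [hermiteFun]
  ring

theorem exp_half_mul_exp_half (x : ℝ) :
    Real.exp (-x ^ 2 / 2) * Real.exp (-x ^ 2 / 2) = Real.exp (-x ^ 2) := by
  rw [← Real.exp_add]
  ring_nf

theorem integrable_hermiteH_mul (j k : ℕ) :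
    Integrable fun x => hermiteH j x * hermiteH k x * Real.exp (-x ^ 2) := by
  have hc : 1 / Real.sqrt (Real.sqrt Real.pi * 2 ^ j * j.factorial) *
      (1 / Real.sqrt (Real.sqrt Real.pi * 2 ^ k * k.factorial)) ≠ 0 := by positivity
  refine (integrable_const_mul_iff (IsUnit.mk0 _ hc) _).1 ?_
  refine (integrable_hermiteFun_mul j k).congr (ae_of_all _ fun x => ?_)
  simp only [hermiteFun_mul_hermiteFun, exp_half_mul_exp_half]

/-- Integration by parts, with `H (k + 1) exp (-x ^ 2) = -(H k exp (-x ^ 2))'`. -/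
theorem integral_hermiteH_mul_succ (j k : ℕ) :
    ∫ x, hermiteH j x * hermiteH (k + 1) x * Real.exp (-x ^ 2) =
      2 * j * ∫ x, hermiteH (j - 1) x * hermiteH k x * Real.exp (-x ^ 2) := by
  have hj : ∀ x, 2 * x * hermiteH j x - hermiteH (j + 1) x = 2 * j * hermiteH (j - 1) x := by
    intro x
    rcases j with _ | j
    · simp [hermiteH_zero, hermiteH_one]
    · rw [hermiteH_add_two]
      push_cast
      simp
  have hderiv : ∀ x, HasDerivAt (fun x => hermiteH j x * hermiteH k x * Real.exp (-x ^ 2))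
      (2 * j * (hermiteH (j - 1) x * hermiteH k x * Real.exp (-x ^ 2)) -
        hermiteH j x * hermiteH (k + 1) x * Real.exp (-x ^ 2)) x := fun x => by
    have he : HasDerivAt (fun y : ℝ => Real.exp (-y ^ 2)) (Real.exp (-x ^ 2) * (-(2 * x))) x := by
      simpa using ((hasDerivAt_pow 2 x).neg).exp
    refine (((hasDerivAt_hermiteH j x).mul (hasDerivAt_hermiteH k x)).mul he).congr_deriv ?_
    simp only [Pi.mul_apply]
    rw [hj]
    ring
  have h0 := integral_eq_zero_of_hasDerivAt_of_integrable hderiv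
    (((integrable_hermiteH_mul (j - 1) k).const_mul _).sub (integrable_hermiteH_mul j (k + 1)))
    (integrable_hermiteH_mul j k)
  rw [integral_sub ((integrable_hermiteH_mul (j - 1) k).const_mul _)
    (integrable_hermiteH_mul j (k + 1)), integral_const_mul] at h0
  linarith

theorem integral_hermiteH_mul (j k : ℕ) :
    ∫ x, hermiteH j x * hermiteH k x * Real.exp (-x ^ 2) =
      if j = k then Real.sqrt Real.pi * 2 ^ k * k.factorial else 0 := by
  induction k generalizing j with
  | zero =>
    rcases j with _ | j
    · simp only [hermiteH_zero, one_mul]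
      simpa using integral_gaussian 1
    · simp only [mul_comm (hermiteH (j + 1) _)]
      rw [integral_hermiteH_mul_succ]
      simp
  | succ k ih =>
    rw [integral_hermiteH_mul_succ, ih]
    rcases j with _ | j
    · simp
    · simp only [Nat.add_sub_cancel, Nat.add_right_cancel_iff]
      split_ifs with h
      · subst h
        rw [Nat.factorial_succ]
        push_cast
        ring
      · simp

theorem integral_hermiteFun_mul (j k : ℕ) :
    ∫ x, hermiteFun j x * hermiteFun k x = if j = k then 1 else 0 := by
  simp only [hermiteFun_mul_hermiteFun, exp_half_mul_exp_half]
  rw [integral_const_mul, integral_hermiteH_mul]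
  split_ifs with h
  · subst h
    have : 0 < Real.sqrt Real.pi * 2 ^ j * j.factorial := by positivity
    rw [div_mul_div_comm, Real.mul_self_sqrt this.le]
    field_simp
  · simp

/-! ### Mehler's formula -/

/-- The integrand `(-2 i u) ^ k exp (-u ^ 2 + 2 i u x)`, whose integral in `u` is a multiple of
`H k (x) exp (-x ^ 2)`. -/
noncomputable def fourierIntegrand (x : ℝ) (k : ℕ) (u : ℝ) : ℂ :=
  (-2 * Complex.I * u) ^ k * Complex.exp (-u ^ 2 + 2 * Complex.I * x * u)

theorem continuous_fourierIntegrand (x : ℝ) (k : ℕ) : Continuous (fourierIntegrand x k) := by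
  unfold fourierIntegrand
  fun_prop

theorem norm_fourierIntegrand (x : ℝ) (k : ℕ) (u : ℝ) :
    ‖fourierIntegrand x k u‖ = (2 * |u|) ^ k * Real.exp (-u ^ 2) := by
  rw [fourierIntegrand, norm_mul, norm_pow, norm_mul, norm_mul, Complex.norm_exp]
  simp [← Complex.ofReal_pow]

theorem integrable_fourierIntegrand (x : ℝ) (k : ℕ) : Integrable (fourierIntegrand x k) := by
  refine ((integrable_exp_neg_mul_sq (b := 1 / 2) (by norm_num)).const_mul
    (k.factorial * Real.exp 2)).mono' (continuous_fourierIntegrand x k).aestronglyMeasurable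
    (ae_of_all _ fun u => ?_)
  rw [norm_fourierIntegrand]
  have h1 : (2 * |u|) ^ k ≤ k.factorial * Real.exp (2 * |u|) := by
    have := Real.pow_div_factorial_le_exp (2 * |u|) (by positivity) k
    rw [div_le_iff₀ (by positivity)] at this
    linarith
  have h2 : Real.exp (2 * |u|) * Real.exp (-u ^ 2) ≤
      Real.exp 2 * Real.exp (-(1 / 2) * u ^ 2) := by
    rw [← Real.exp_add, ← Real.exp_add, Real.exp_le_exp]
    nlinarith [sq_nonneg (|u| - 2), sq_abs u]
  calc (2 * |u|) ^ k * Real.exp (-u ^ 2)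
      ≤ k.factorial * Real.exp (2 * |u|) * Real.exp (-u ^ 2) := by gcongr
    _ = k.factorial * (Real.exp (2 * |u|) * Real.exp (-u ^ 2)) := by ring
    _ ≤ k.factorial * (Real.exp 2 * Real.exp (-(1 / 2) * u ^ 2)) := by gcongr
    _ = _ := by ring

theorem integral_fourierIntegrand_succ (x : ℝ) (k : ℕ) :
    ∫ u, fourierIntegrand x (k + 1) u =
      2 * x * (∫ u, fourierIntegrand x k u) - 2 * k * ∫ u, fourierIntegrand x (k - 1) u := by
  have hderiv : ∀ u, HasDerivAt (fun u => Complex.I * fourierIntegrand x k u)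
      (fourierIntegrand x (k + 1) u - 2 * x * fourierIntegrand x k u +
        2 * k * fourierIntegrand x (k - 1) u) u := fun u => by
    have hu : HasDerivAt (fun u : ℝ => (u : ℂ)) 1 u := Complex.ofRealCLM.hasDerivAt
    have h1 : HasDerivAt (fun u : ℝ => (-2 * Complex.I * u : ℂ) ^ k)
        (k * (-2 * Complex.I * u) ^ (k - 1) * (-2 * Complex.I * 1)) u :=
      (hu.const_mul (-2 * Complex.I)).pow k
    have h2 : HasDerivAt (fun u : ℝ => Complex.exp (-(u : ℂ) ^ 2 + 2 * Complex.I * x * u))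
        (Complex.exp (-(u : ℂ) ^ 2 + 2 * Complex.I * x * u) *
          (-((2 : ℕ) * (u : ℂ) ^ (2 - 1) * 1) + 2 * Complex.I * x * 1)) u :=
      ((hu.pow 2).neg.add (hu.const_mul _)).cexp
    refine ((h1.mul h2).const_mul Complex.I).congr_deriv ?_
    simp only [fourierIntegrand]
    have hI := Complex.I_sq
    push_cast
    rw [pow_succ (-2 * Complex.I * (u : ℂ)) k]
    linear_combination (((-2 * Complex.I * u) ^ k * 2 * x - 2 * k *
      (-2 * Complex.I * u) ^ (k - 1)) *
        Complex.exp (-(u : ℂ) ^ 2 + 2 * Complex.I * x * u)) * hI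
  have i0 := (integrable_fourierIntegrand x k).const_mul (2 * x : ℂ)
  have i1 := integrable_fourierIntegrand x (k + 1)
  have i2 := (integrable_fourierIntegrand x (k - 1)).const_mul (2 * k : ℂ)
  have h0 := integral_eq_zero_of_hasDerivAt_of_integrable hderiv ((i1.sub i0).add i2)
    ((integrable_fourierIntegrand x k).const_mul _)
  have h3 := integral_add (i1.sub i0) i2
  simp only [Pi.sub_apply] at h3
  rw [h3, integral_sub i1 i0, integral_const_mul, integral_const_mul] at h0
  linear_combination h0

theorem integral_fourierIntegrand_zero (x : ℝ) :
    ∫ u, fourierIntegrand x 0 u = Real.sqrt Real.pi * Complex.exp (-x ^ 2) := by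
  have h := integral_cexp_quadratic (b := -1) (by simp) (2 * Complex.I * x) 0
  simp only [neg_neg, div_one, add_zero, neg_one_mul] at h
  simp only [fourierIntegrand, pow_zero, one_mul, h]
  congr 1
  · rw [Real.sqrt_eq_rpow, Complex.ofReal_cpow Real.pi_pos.le]
    norm_num
  · congr 1
    linear_combination (x ^ 2 : ℂ) * Complex.I_sq

/-- Fourier representation of the Hermite polynomials. -/
theorem integral_fourierIntegrand (x : ℝ) (k : ℕ) :
    ∫ u, fourierIntegrand x k u = Real.sqrt Real.pi * Complex.exp (-x ^ 2) * hermiteH k x := by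
  induction k using Nat.strong_induction_on with
  | _ k ih =>
    match k with
    | 0 => rw [integral_fourierIntegrand_zero, hermiteH_zero, Complex.ofReal_one, mul_one]
    | 1 =>
      rw [integral_fourierIntegrand_succ, integral_fourierIntegrand_zero, hermiteH_one]
      push_cast
      ring
    | k + 2 =>
      rw [integral_fourierIntegrand_succ, ih (k + 1) (by omega), Nat.add_sub_cancel,
        ih k (by omega), hermiteH_add_two]
      push_cast
      ring

/-- The Mehler kernel `∑ k, r ^ k φ k (x) φ k (y)` in closed form. -/
noncomputable def mehlerKernel (r x y : ℝ) : ℝ :=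
  1 / Real.sqrt (Real.pi * (1 - r ^ 2)) *
    Real.exp (-((1 + r ^ 2) * (x ^ 2 + y ^ 2) - 4 * r * x * y) / (2 * (1 - r ^ 2)))

theorem mehlerKernel_comm (r x y : ℝ) : mehlerKernel r x y = mehlerKernel r y x := by
  unfold mehlerKernel
  ring_nf

/-- The Gaussian integral that remains when the generating function of the `H k (y)`, at the point
`-i r u`, is integrated against the Fourier representation in `x`. -/
theorem integral_mehler_fourier {r : ℝ} (hr0 : 0 ≤ r) (hr1 : r < 1) (x y : ℝ) :
    ∫ u : ℝ, Complex.exp (2 * y * (-Complex.I * r * u) - (-Complex.I * r * u) ^ 2) *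
        fourierIntegrand x 0 u =
      (Real.sqrt Real.pi / Real.sqrt (1 - r ^ 2) *
        Real.exp (-(x - r * y) ^ 2 / (1 - r ^ 2)) : ℝ) := by
  have hr : 0 < 1 - r ^ 2 := by nlinarith
  have hrc : (1 - r ^ 2 : ℂ) ≠ 0 := by exact_mod_cast hr.ne'
  have h := integral_cexp_quadratic (b := -(1 - r ^ 2 : ℝ))
    (by rw [Complex.neg_re, Complex.ofReal_re]; linarith) (2 * Complex.I * (x - r * y)) 0
  simp only [fourierIntegrand, pow_zero, one_mul, ← Complex.exp_add]
  have h1 : ∀ u : ℝ, 2 * y * (-Complex.I * r * u) - (-Complex.I * r * u) ^ 2 +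
      (-(u : ℂ) ^ 2 + 2 * Complex.I * x * u) =
      -(1 - r ^ 2 : ℝ) * u ^ 2 + 2 * Complex.I * (x - r * y) * u + 0 := fun u => by
    push_cast
    linear_combination (-(r * u) ^ 2 : ℂ) * Complex.I_sq
  simp only [h1, h]
  push_cast
  congr 1
  · rw [neg_neg, ← Complex.ofReal_div, ← Real.sqrt_div Real.pi_pos.le, Real.sqrt_eq_rpow,
      Complex.ofReal_cpow (by positivity)]
    norm_num
  · congr 1
    field_simp
    linear_combination ((x - r * y) ^ 2 * 4 : ℂ) * Complex.I_sq

/-- Mehler's formula for the polynomials: `H k (x)` is replaced by its Fourier representation, the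
sum over `k` is the generating function of the `H k (y)` under the integral, and a Gaussian integral
remains. -/
theorem hasSum_hermiteH_mul {r : ℝ} (hr0 : 0 ≤ r) (hr1 : r < 1) (x y : ℝ) :
    HasSum (fun k => (r / 2) ^ k / k.factorial * (hermiteH k x * hermiteH k y))
      (Real.exp (x ^ 2) / Real.sqrt (1 - r ^ 2) *
        Real.exp (-(x - r * y) ^ 2 / (1 - r ^ 2))) := by
  let F : ℕ → ℝ → ℂ := fun k u =>
    ((r / 2) ^ k / k.factorial * hermiteH k y : ℂ) * fourierIntegrand x k u
  have hsum : HasSum (fun k => ∫ u, F k u) (∫ u : ℝ,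
      Complex.exp (2 * y * (-Complex.I * r * u) - (-Complex.I * r * u) ^ 2) *
        fourierIntegrand x 0 u) := by
    refine hasSum_integral_of_dominated_convergence
      (fun k u => hermiteMajorant y k * (r * |u|) ^ k / k.factorial * Real.exp (-u ^ 2))
      (fun k => (continuous_const.mul (continuous_fourierIntegrand x k)).aestronglyMeasurable)
      (fun k => ae_of_all _ fun u => ?_)
      (ae_of_all _ fun u => ((hasSum_hermiteMajorant y (r * |u|)).mul_right _).summable) ?_
      (ae_of_all _ fun u => ?_)
    · simp only [F]
      rw [norm_mul, norm_fourierIntegrand, norm_mul, norm_div, norm_pow, norm_div]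
      simp only [Complex.norm_real, Complex.norm_natCast, Complex.norm_ofNat, Real.norm_eq_abs,
        abs_of_nonneg hr0]
      have := abs_hermiteH_le y k
      have h2 : (r * |u|) ^ k = (r / 2) ^ k * (2 * |u|) ^ k := by
        rw [← mul_pow]
        ring_nf
      rw [h2]
      calc (r / 2) ^ k / k.factorial * |hermiteH k y| * ((2 * |u|) ^ k * Real.exp (-u ^ 2))
          ≤ (r / 2) ^ k / k.factorial * hermiteMajorant y k *
              ((2 * |u|) ^ k * Real.exp (-u ^ 2)) := by gcongr
        _ = _ := by ring
    · have h1 : ∀ u, ∑' k : ℕ, hermiteMajorant y k * (r * |u|) ^ k / k.factorial *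
          Real.exp (-u ^ 2) = Real.exp (2 * |y| * (r * |u|) + (r * |u|) ^ 2) *
            Real.exp (-u ^ 2) := fun u =>
        ((hasSum_hermiteMajorant y (r * |u|)).mul_right _).tsum_eq
      simp only [h1]
      have hr : 0 < 1 - r ^ 2 := by nlinarith
      refine integrable_of_abs_le_exp (by fun_prop) (b := (1 - r ^ 2) / 2)
        (C := Real.exp (2 * (|y| * r) ^ 2 / (1 - r ^ 2))) (by linarith) fun u => ?_
      rw [abs_mul, Real.abs_exp, Real.abs_exp, ← Real.exp_add, ← Real.exp_add, Real.exp_le_exp]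
      -- Completing the square, half of the Gaussian decay is kept.
      have h2 : 0 ≤ (2 * (|y| * r) - (1 - r ^ 2) * |u|) ^ 2 / (2 * (1 - r ^ 2)) := by positivity
      have h3 : (2 * (|y| * r) - (1 - r ^ 2) * |u|) ^ 2 / (2 * (1 - r ^ 2)) =
          2 * (|y| * r) ^ 2 / (1 - r ^ 2) - 2 * (|y| * r) * |u| + (1 - r ^ 2) * |u| ^ 2 / 2 := by
        field_simp
        ring
      rw [h3, sq_abs] at h2
      rw [mul_pow, sq_abs]
      linarith
    · have := (hasSum_hermiteH y (-Complex.I * r * u)).mul_right (fourierIntegrand x 0 u)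
      convert! this using 2 with k
      simp only [F, fourierIntegrand, pow_zero, one_mul]
      have h2 : (-Complex.I * r * u) ^ k = (r / 2 : ℂ) ^ k * (-2 * Complex.I * u) ^ k := by
        rw [← mul_pow]
        ring_nf
      rw [h2]
      ring
  rw [integral_mehler_fourier hr0 hr1] at hsum
  have h4 : ∀ k, ∫ u, F k u = ((Real.sqrt Real.pi * Real.exp (-x ^ 2)) *
      ((r / 2) ^ k / k.factorial * (hermiteH k x * hermiteH k y)) : ℝ) := fun k => by
    simp only [F]
    rw [integral_const_mul, integral_fourierIntegrand]
    push_cast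
    ring
  simp only [h4] at hsum
  rw [Complex.hasSum_ofReal] at hsum
  have h5 := hsum.mul_left (Real.exp (x ^ 2) / Real.sqrt Real.pi)
  have hpi : Real.sqrt Real.pi ≠ 0 := by positivity
  have hexp : Real.exp (x ^ 2) * Real.exp (-x ^ 2) = 1 := by simp [← Real.exp_add]
  convert! h5 using 1
  · funext k
    field_simp
    linear_combination (-(r / 2) ^ k * hermiteH k x * hermiteH k y) * hexp
  · field_simp

/-- **Mehler's formula**. -/
theorem hasSum_mehlerKernel {r : ℝ} (hr0 : 0 ≤ r) (hr1 : r < 1) (x y : ℝ) :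
    HasSum (fun k => r ^ k * hermiteFun k x * hermiteFun k y) (mehlerKernel r x y) := by
  have hr : 0 < 1 - r ^ 2 := by nlinarith
  have h := (hasSum_hermiteH_mul hr0 hr1 x y).mul_left
    (1 / Real.sqrt Real.pi * (Real.exp (-x ^ 2 / 2) * Real.exp (-y ^ 2 / 2)))
  convert! h using 1
  · funext k
    have hk : 0 ≤ Real.sqrt Real.pi * 2 ^ k * k.factorial := by positivity
    rw [mul_assoc, hermiteFun_mul_hermiteFun, div_mul_div_comm, Real.mul_self_sqrt hk, div_pow]
    field_simp
  · rw [mehlerKernel, Real.sqrt_mul Real.pi_pos.le]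
    have : Real.exp (-((1 + r ^ 2) * (x ^ 2 + y ^ 2) - 4 * r * x * y) / (2 * (1 - r ^ 2))) =
        Real.exp (-x ^ 2 / 2) * Real.exp (-y ^ 2 / 2) *
          (Real.exp (x ^ 2) * Real.exp (-(x - r * y) ^ 2 / (1 - r ^ 2))) := by
      rw [← Real.exp_add, ← Real.exp_add, ← Real.exp_add]
      congr 1
      field_simp
      ring
    rw [this]
    field_simp

theorem continuous_mehlerKernel (r : ℝ) :
    Continuous fun z : ℝ × ℝ => mehlerKernel r z.1 z.2 := by
  unfold mehlerKernel
  fun_prop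

theorem mehlerKernel_nonneg (r x y : ℝ) : 0 ≤ mehlerKernel r x y := by
  unfold mehlerKernel
  positivity

theorem mehlerKernel_le {r : ℝ} (hr0 : 0 ≤ r) (hr1 : r < 1) (x y : ℝ) :
    mehlerKernel r x y ≤ 1 / Real.sqrt (Real.pi * (1 - r ^ 2)) *
      Real.exp (-((1 - r) ^ 2 / (2 * (1 - r ^ 2))) * x ^ 2) := by
  have hr : 0 < 1 - r ^ 2 := by nlinarith
  unfold mehlerKernel
  refine mul_le_mul_of_nonneg_left (Real.exp_le_exp.2 ?_) (by positivity)
  rw [neg_mul, div_mul_eq_mul_div, ← neg_div]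
  refine div_le_div_of_nonneg_right ?_ (by positivity)
  nlinarith [mul_nonneg hr0 (sq_nonneg (x - y)), mul_nonneg (sq_nonneg (1 - r)) (sq_nonneg y)]

/-- The Mehler series on the diagonal controls the squares of the Hermite functions, and hence their
absolute values. -/
theorem summable_pow_mul_abs_hermiteFun {r : ℝ} (hr0 : 0 ≤ r) (hr1 : r < 1) (x : ℝ) :
    Summable fun k => r ^ k * |hermiteFun k x| := by
  refine Summable.of_nonneg_of_le (fun k => by positivity) (fun k => ?_)
    ((summable_geometric_of_lt_one hr0 hr1).add (hasSum_mehlerKernel hr0 hr1 x x).summable)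
  have h : |hermiteFun k x| ≤ 1 + hermiteFun k x * hermiteFun k x := by
    rw [← abs_mul_abs_self (hermiteFun k x)]
    nlinarith [sq_nonneg (|hermiteFun k x| - 1), abs_nonneg (hermiteFun k x)]
  calc r ^ k * |hermiteFun k x| ≤ r ^ k * (1 + hermiteFun k x * hermiteFun k x) := by gcongr
    _ = _ := by ring

/-- Integration of a square integrable function against the Mehler kernel, term by term. -/
theorem hasSum_integral_mul_mehlerKernel {r : ℝ} (hr0 : 0 ≤ r) (hr1 : r < 1) {u : ℝ → ℝ}
    (hu : Continuous u) (hu2 : Integrable fun z => u z * u z) (y : ℝ) :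
    HasSum (fun k => r ^ k * hermiteFun k y * ∫ z, u z * hermiteFun k z)
      (∫ z, u z * mehlerKernel r z y) := by
  have hb : ∀ k z, |u z * hermiteFun k z| ≤
      u z * u z + hermiteFun k z * hermiteFun k z := fun k z => by
    rw [abs_mul]
    nlinarith [sq_nonneg (|u z| - |hermiteFun k z|), sq_abs (u z), sq_abs (hermiteFun k z),
      sq_nonneg (u z), sq_nonneg (hermiteFun k z)]
  have hi : ∀ k, Integrable fun z => u z * hermiteFun k z := fun k =>
    (hu2.add (integrable_hermiteFun_mul k k)).mono'
      (hu.mul (continuous_hermiteFun k)).aestronglyMeasurable (ae_of_all _ (hb k))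
  have hle : ∀ k, ∫ z, |u z * hermiteFun k z| ≤ (∫ z, u z * u z) + 1 := fun k => by
    refine (integral_mono (hi k).abs (hu2.add (integrable_hermiteFun_mul k k)) (hb k)).trans_eq ?_
    simp only [Pi.add_apply]
    rw [integral_add hu2 (integrable_hermiteFun_mul k k), integral_hermiteFun_mul, if_pos rfl]
  have h := hasSum_integral_of_summable_integral_norm
    (F := fun k z => r ^ k * hermiteFun k y * (u z * hermiteFun k z))
    (fun k => (hi k).const_mul _) (by
      refine Summable.of_nonneg_of_le (fun k => integral_nonneg fun z => norm_nonneg _)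
        (fun k => ?_) ((summable_pow_mul_abs_hermiteFun hr0 hr1 y).mul_right
          ((∫ z, u z * u z) + 1))
      simp only [norm_mul (r ^ k * hermiteFun k y)]
      rw [integral_const_mul, norm_mul, norm_pow, Real.norm_of_nonneg hr0]
      exact mul_le_mul_of_nonneg_left (hle k) (by positivity))
  simp only [integral_const_mul] at h
  suffices e : ∫ z, u z * mehlerKernel r z y =
      ∫ z, ∑' k, r ^ k * hermiteFun k y * (u z * hermiteFun k z) by
    rw [e]
    exact h
  refine integral_congr_ae (ae_of_all _ fun z => ?_)
  have h2 := (hasSum_mehlerKernel hr0 hr1 z y).mul_left (u z)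
  simp only
  rw [← h2.tsum_eq]
  refine tsum_congr fun k => ?_
  ring

theorem integral_hermiteFun_mul_mehlerKernel {r : ℝ} (hr0 : 0 ≤ r) (hr1 : r < 1) (j : ℕ) (y : ℝ) :
    ∫ z, hermiteFun j z * mehlerKernel r z y = r ^ j * hermiteFun j y := by
  have h := hasSum_integral_mul_mehlerKernel hr0 hr1 (continuous_hermiteFun j)
    (integrable_hermiteFun_mul j j) y
  simp only [integral_hermiteFun_mul, mul_ite, mul_one, mul_zero] at h
  rw [← h.tsum_eq, tsum_eq_single j fun k hk => if_neg hk.symm, if_pos rfl]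

/-- The semigroup property of the Mehler kernel. -/
theorem integral_mehlerKernel_mul_mehlerKernel {q r : ℝ} (hq0 : 0 ≤ q) (hq1 : q < 1)
    (hr0 : 0 ≤ r) (hr1 : r < 1) (x y : ℝ) :
    ∫ z, mehlerKernel q x z * mehlerKernel r z y = mehlerKernel (q * r) x y := by
  have hc : Continuous fun z => mehlerKernel q x z :=
    (continuous_mehlerKernel q).comp (continuous_const.prodMk continuous_id)
  have hq : 0 < 1 - q ^ 2 := by nlinarith
  have hq' : 0 < 1 - q := by linarith
  have hi : Integrable fun z => mehlerKernel q x z * mehlerKernel q x z := by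
    refine integrable_of_abs_le_exp (hc.mul hc) (b := (1 - q) ^ 2 / (2 * (1 - q ^ 2)))
      (C := 1 / Real.sqrt (Real.pi * (1 - q ^ 2)) * (1 / Real.sqrt (Real.pi * (1 - q ^ 2))))
      (by positivity) fun z => ?_
    have h1 := mehlerKernel_le hq0 hq1 z x
    rw [mehlerKernel_comm] at h1
    have h2 : mehlerKernel q x z ≤ 1 / Real.sqrt (Real.pi * (1 - q ^ 2)) :=
      (mehlerKernel_le hq0 hq1 x z).trans (mul_le_of_le_one_right (by positivity)
        (Real.exp_le_one_iff.2 (by rw [neg_mul, neg_nonpos]; positivity)))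
    rw [abs_of_nonneg (mul_nonneg (mehlerKernel_nonneg _ _ _) (mehlerKernel_nonneg _ _ _)),
      mul_assoc]
    exact mul_le_mul h2 h1 (mehlerKernel_nonneg _ _ _) (by positivity)
  have h := hasSum_integral_mul_mehlerKernel hr0 hr1 hc hi y
  have h2 : ∀ k, ∫ z, mehlerKernel q x z * hermiteFun k z = q ^ k * hermiteFun k x := fun k => by
    rw [← integral_hermiteFun_mul_mehlerKernel hq0 hq1]
    refine integral_congr_ae (ae_of_all _ fun z => ?_)
    simp only
    rw [mehlerKernel_comm, mul_comm]
  simp only [h2] at h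
  refine h.unique ?_
  have hqr : q * r < 1 := by nlinarith
  convert! hasSum_mehlerKernel (mul_nonneg hq0 hr0) hqr x y using 2 with k
  rw [mul_pow]
  ring

/-! ### The extended Hermite kernel -/

theorem integrable_hermiteFun (k : ℕ) : Integrable (hermiteFun k) := by
  obtain ⟨C, hC⟩ := exists_abs_hermiteFun_le k
  refine integrable_of_abs_le_exp (continuous_hermiteFun k) (C := C) (b := 1 / 4) (by norm_num)
    fun x => (hC x).trans_eq ?_
  ring_nf

theorem exists_abs_hermiteFun_le_const (k : ℕ) : ∃ C, ∀ x, |hermiteFun k x| ≤ C := by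
  obtain ⟨C, hC⟩ := exists_abs_hermiteFun_le k
  refine ⟨|C|, fun x => (hC x).trans ?_⟩
  calc C * Real.exp (-x ^ 2 / 4) ≤ |C| * Real.exp (-x ^ 2 / 4) := by
        gcongr
        exact le_abs_self C
    _ ≤ |C| * 1 := by
        gcongr
        rw [Real.exp_le_one_iff]
        have := sq_nonneg x
        linarith
    _ = |C| := mul_one _

/-- The functions biorthogonal to `hermiteP t`. -/
noncomputable def hermiteQ (t : ℝ) (k : ℕ) (x : ℝ) : ℝ :=
  1 / Real.sqrt (2 * t) * (Real.sqrt t ^ k)⁻¹ * hermiteFun k (x / Real.sqrt (2 * t))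

/-- The Hermite functions at time `t`, with the normalization in which they are transported by the
heat flow without a factor. -/
noncomputable def hermiteP (t : ℝ) (k : ℕ) (x : ℝ) : ℝ :=
  Real.sqrt t ^ k * hermiteFun k (x / Real.sqrt (2 * t))

/-- The transition function from time `t` to time `s`. It is the heat kernel up to the factors
`exp (x ^ 2 / (4 s))` and `exp (-y ^ 2 / (4 t))`. -/
noncomputable def hermiteT (s x t y : ℝ) : ℝ :=
  1 / Real.sqrt (2 * s) *
    mehlerKernel (Real.sqrt t / Real.sqrt s) (x / Real.sqrt (2 * s)) (y / Real.sqrt (2 * t))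

theorem continuous_hermiteQ (t : ℝ) (k : ℕ) : Continuous (hermiteQ t k) :=
  continuous_const.mul ((continuous_hermiteFun k).comp (continuous_id.div_const _))

theorem continuous_hermiteP (t : ℝ) (k : ℕ) : Continuous (hermiteP t k) :=
  continuous_const.mul ((continuous_hermiteFun k).comp (continuous_id.div_const _))

theorem continuous_hermiteT (s t : ℝ) : Continuous fun z : ℝ × ℝ => hermiteT s z.1 t z.2 := by
  unfold hermiteT mehlerKernel
  fun_prop

theorem integrable_hermiteQ {t : ℝ} (ht : 0 < t) (k : ℕ) : Integrable (hermiteQ t k) :=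
  ((integrable_hermiteFun k).comp_div (by positivity)).const_mul _

theorem sqrt_div_sqrt_mem {s t : ℝ} (ht : 0 < t) (hts : t < s) :
    0 ≤ Real.sqrt t / Real.sqrt s ∧ Real.sqrt t / Real.sqrt s < 1 := by
  have hs : 0 < s := ht.trans hts
  refine ⟨by positivity, ?_⟩
  rw [div_lt_one (by positivity)]
  exact Real.sqrt_lt_sqrt ht.le hts

theorem exists_abs_hermiteT_le {s t : ℝ} (ht : 0 < t) (hts : t < s) :
    ∃ g : ℝ → ℝ, Integrable g ∧ ∀ x y, |hermiteT s x t y| ≤ g x := by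
  have hs : 0 < s := ht.trans hts
  obtain ⟨h0, h1⟩ := sqrt_div_sqrt_mem ht hts
  set r := Real.sqrt t / Real.sqrt s with hr
  have hr2 : 0 < 1 - r ^ 2 := by nlinarith
  have hr1 : 0 < 1 - r := by linarith
  refine ⟨fun x => 1 / Real.sqrt (2 * s) * (1 / Real.sqrt (Real.pi * (1 - r ^ 2)) *
    Real.exp (-((1 - r) ^ 2 / (2 * (1 - r ^ 2))) * (x / Real.sqrt (2 * s)) ^ 2)), ?_,
    fun x y => ?_⟩
  · exact (((integrable_exp_neg_mul_sq (by positivity)).comp_div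
      (by positivity)).const_mul _).const_mul _
  · rw [hermiteT, abs_mul, abs_of_nonneg (by positivity : 0 ≤ 1 / Real.sqrt (2 * s)),
      abs_of_nonneg (mehlerKernel_nonneg _ _ _)]
    exact mul_le_mul_of_nonneg_left (mehlerKernel_le h0 h1 _ _) (by positivity)

/-- Substitution in the integral of a product of two functions of `z / c`. -/
theorem integral_mul_comp_div (a b : ℝ) {c : ℝ} (hc : 0 < c) (u v : ℝ → ℝ) :
    ∫ z, (a * u (z / c)) * (b * v (z / c)) = a * b * c * ∫ z, u z * v z := by
  have h : ∀ z, (a * u (z / c)) * (b * v (z / c)) = a * b * (u (z / c) * v (z / c)) :=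
    fun z => by ring
  simp only [h]
  rw [integral_const_mul, Measure.integral_comp_div (fun z => u z * v z), abs_of_pos hc,
    smul_eq_mul]
  ring

theorem integral_hermiteP_mul_hermiteQ {t : ℝ} (ht : 0 < t) (j k : ℕ) :
    ∫ z, hermiteP t j z * hermiteQ t k z = if j = k then 1 else 0 := by
  simp only [hermiteP, hermiteQ]
  rw [integral_mul_comp_div _ _ (by positivity), integral_hermiteFun_mul]
  split_ifs with h
  · subst h
    field_simp
  · simp

theorem integral_hermiteT_mul_hermiteQ {s t : ℝ} (ht : 0 < t) (hts : t < s) (k : ℕ) (x : ℝ) :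
    ∫ z, hermiteT s x t z * hermiteQ t k z = hermiteQ s k x := by
  have hs : 0 < s := ht.trans hts
  obtain ⟨h0, h1⟩ := sqrt_div_sqrt_mem ht hts
  simp only [hermiteT, hermiteQ]
  rw [integral_mul_comp_div _ _ (by positivity)
    (mehlerKernel (Real.sqrt t / Real.sqrt s) (x / Real.sqrt (2 * s)))]
  simp only [mehlerKernel_comm _ (x / Real.sqrt (2 * s)), mul_comm (mehlerKernel _ _ _)]
  rw [integral_hermiteFun_mul_mehlerKernel h0 h1, div_pow]
  field_simp

theorem integral_hermiteP_mul_hermiteT {s t : ℝ} (ht : 0 < t) (hts : t < s) (k : ℕ) (y : ℝ) :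
    ∫ z, hermiteP s k z * hermiteT s z t y = hermiteP t k y := by
  have hs : 0 < s := ht.trans hts
  obtain ⟨h0, h1⟩ := sqrt_div_sqrt_mem ht hts
  simp only [hermiteT, hermiteP]
  rw [integral_mul_comp_div _ _ (by positivity) _ fun z =>
      mehlerKernel (Real.sqrt t / Real.sqrt s) z (y / Real.sqrt (2 * t)),
    integral_hermiteFun_mul_mehlerKernel h0 h1, div_pow]
  field_simp

theorem integral_hermiteT_mul_hermiteT {s t u : ℝ} (ht : 0 < t) (hts : t < s) (hsu : s < u)
    (x y : ℝ) : ∫ z, hermiteT u x s z * hermiteT s z t y = hermiteT u x t y := by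
  have hs : 0 < s := ht.trans hts
  have hu : 0 < u := hs.trans hsu
  obtain ⟨h0, h1⟩ := sqrt_div_sqrt_mem ht hts
  obtain ⟨h2, h3⟩ := sqrt_div_sqrt_mem hs hsu
  simp only [hermiteT]
  rw [integral_mul_comp_div _ _ (by positivity)
      (mehlerKernel (Real.sqrt s / Real.sqrt u) (x / Real.sqrt (2 * u))) fun z =>
      mehlerKernel (Real.sqrt t / Real.sqrt s) z (y / Real.sqrt (2 * t)),
    integral_mehlerKernel_mul_mehlerKernel h2 h3 h0 h1]
  have : Real.sqrt s / Real.sqrt u * (Real.sqrt t / Real.sqrt s) =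
      Real.sqrt t / Real.sqrt u := by field_simp
  rw [this]
  field_simp

/-- The extended Hermite kernel as an instance of the general notion. -/
theorem exists_extendedKernel (N : ℕ) {M : ℕ} {t : Fin (M + 1) → ℝ} (ht : StrictMono t)
    (h0 : ∀ m, 0 < t m) :
    ∃ E : ExtendedKernel (Fin (M + 1)) N, (E.Q = fun m (k : Fin N) => hermiteQ (t m) k) ∧
      (E.P = fun m (k : Fin N) => hermiteP (t m) k) ∧
      E.T = fun m n x y => hermiteT (t m) x (t n) y := by
  have hP : ∀ (m : Fin (M + 1)) (k : Fin N), ∃ C, ∀ x, |hermiteP (t m) k x| ≤ C := fun m k => by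
    obtain ⟨C, hC⟩ := exists_abs_hermiteFun_le_const k
    refine ⟨Real.sqrt (t m) ^ (k : ℕ) * C, fun x => ?_⟩
    rw [hermiteP, abs_mul, abs_of_nonneg (by positivity)]
    exact mul_le_mul_of_nonneg_left (hC _) (by positivity)
  choose C hC using hP
  have hT : ∀ m n : Fin (M + 1), ∃ g : ℝ → ℝ, Integrable g ∧ (∀ x, 0 ≤ g x) ∧
      (n < m → ∀ x y, |hermiteT (t m) x (t n) y| ≤ g x) := fun m n => by
    by_cases h : n < m
    · obtain ⟨g, hg, hg'⟩ := exists_abs_hermiteT_le (h0 n) (ht h)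
      exact ⟨g, hg, fun x => (abs_nonneg _).trans (hg' x 0), fun _ => hg'⟩
    · exact ⟨0, integrable_zero _ _ _, fun _ => le_rfl, fun h' => absurd h' h⟩
  choose g hg hg0 hgT using hT
  have hC0 : ∀ m k, 0 ≤ C m k := fun m k => (abs_nonneg _).trans (hC m k 0)
  have hQb : ∀ m (k : Fin N) x, |hermiteQ (t m) k x| ≤
      ∑ m, ∑ k : Fin N, |hermiteQ (t m) k x| + ∑ m, ∑ n, g m n x := fun m k x => by
    have h1 : |hermiteQ (t m) k x| ≤ ∑ k : Fin N, |hermiteQ (t m) k x| :=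
      Finset.single_le_sum (f := fun k : Fin N => |hermiteQ (t m) k x|)
        (fun _ _ => abs_nonneg _) (Finset.mem_univ k)
    have h2 : ∑ k : Fin N, |hermiteQ (t m) k x| ≤ ∑ m, ∑ k : Fin N, |hermiteQ (t m) k x| :=
      Finset.single_le_sum (f := fun m => ∑ k : Fin N, |hermiteQ (t m) k x|)
        (fun _ _ => Finset.sum_nonneg fun _ _ => abs_nonneg _) (Finset.mem_univ m)
    have h3 : 0 ≤ ∑ m, ∑ n, g m n x :=
      Finset.sum_nonneg fun m _ => Finset.sum_nonneg fun n _ => hg0 m n x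
    linarith
  have hPb : ∀ m (k : Fin N) x, |hermiteP (t m) k x| ≤ ∑ m, ∑ k, C m k := fun m k x => by
    have h1 : C m k ≤ ∑ k, C m k :=
      Finset.single_le_sum (f := fun k => C m k) (fun k _ => hC0 m k) (Finset.mem_univ k)
    have h2 : ∑ k, C m k ≤ ∑ m, ∑ k, C m k :=
      Finset.single_le_sum (f := fun m => ∑ k, C m k)
        (fun m _ => Finset.sum_nonneg fun k _ => hC0 m k) (Finset.mem_univ m)
    exact (hC m k x).trans (h1.trans h2)
  have hTb : ∀ m n, n < m → ∀ x y, |hermiteT (t m) x (t n) y| ≤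
      ∑ m, ∑ k : Fin N, |hermiteQ (t m) k x| + ∑ m, ∑ n, g m n x := fun m n h x y => by
    have h1 : g m n x ≤ ∑ n, g m n x :=
      Finset.single_le_sum (f := fun n => g m n x) (fun n _ => hg0 m n x) (Finset.mem_univ n)
    have h2 : ∑ n, g m n x ≤ ∑ m, ∑ n, g m n x :=
      Finset.single_le_sum (f := fun m => ∑ n, g m n x)
        (fun m _ => Finset.sum_nonneg fun n _ => hg0 m n x) (Finset.mem_univ m)
    have h3 : 0 ≤ ∑ m, ∑ k : Fin N, |hermiteQ (t m) k x| :=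
      Finset.sum_nonneg fun m _ => Finset.sum_nonneg fun k _ => abs_nonneg _
    have := hgT m n h x y
    linarith
  have hPQ : ∀ m (j k : Fin N), ∫ z, hermiteP (t m) j z * hermiteQ (t m) k z =
      if j = k then 1 else 0 := fun m j k => by
    rw [integral_hermiteP_mul_hermiteQ (h0 m)]
    simp [Fin.ext_iff]
  have hgi : Integrable fun x =>
      ∑ m, ∑ k : Fin N, |hermiteQ (t m) k x| + ∑ m, ∑ n, g m n x := by
    refine Integrable.add (f := fun x => ∑ m, ∑ k : Fin N, |hermiteQ (t m) k x|)
      (g := fun x => ∑ m, ∑ n, g m n x) ?_ ?_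
    · exact integrable_finsetSum _ fun m _ => integrable_finsetSum _ fun k _ =>
        (integrable_hermiteQ (h0 m) k).abs
    · exact integrable_finsetSum _ fun m _ => integrable_finsetSum _ fun n _ => hg m n
  refine ⟨{ Q := fun m k => hermiteQ (t m) k
            P := fun m k => hermiteP (t m) k
            T := fun m n x y => hermiteT (t m) x (t n) y
            g := fun x => ∑ m, ∑ k : Fin N, |hermiteQ (t m) k x| + ∑ m, ∑ n, g m n x
            C := ∑ m, ∑ k, C m k
            continuous_Q := fun m k => continuous_hermiteQ _ _
            continuous_P := fun m k => continuous_hermiteP _ _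
            continuous_T := fun m n _ => continuous_hermiteT _ _
            integrable_g := hgi
            abs_Q_le := hQb
            abs_P_le := hPb
            abs_T_le := hTb
            integral_P_mul_Q := hPQ
            integral_T_mul_Q := fun m n h k x => integral_hermiteT_mul_hermiteQ (h0 n) (ht h) k x
            integral_P_mul_T := fun m n h k y => integral_hermiteP_mul_hermiteT (h0 n) (ht h) k y
            integral_T_mul_T := fun l m n h h' x y =>
              integral_hermiteT_mul_hermiteT (h0 n) (ht h) (ht h') x y }, rfl, rfl, rfl⟩

theorem kernelTerm_eq {s t : ℝ} (hs : 0 < s) (ht : 0 < t) (x y : ℝ) (k : ℕ) :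
    kernelTerm s x t y k = (Real.sqrt t / Real.sqrt s) ^ k *
      hermiteFun k (x / Real.sqrt (2 * s)) * hermiteFun k (y / Real.sqrt (2 * t)) := by
  have h : (t / s) ^ ((k : ℝ) / 2) = (Real.sqrt t / Real.sqrt s) ^ k := by
    rw [← Real.sqrt_div ht.le, Real.sqrt_eq_rpow (t / s), ← Real.rpow_natCast,
      ← Real.rpow_mul (by positivity)]
    ring_nf
  rw [kernelTerm, h]

theorem hasSum_kernelTerm {s t : ℝ} (ht : 0 < t) (hts : t < s) (x y : ℝ) :
    HasSum (kernelTerm s x t y) (mehlerKernel (Real.sqrt t / Real.sqrt s)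
      (x / Real.sqrt (2 * s)) (y / Real.sqrt (2 * t))) := by
  obtain ⟨h0, h1⟩ := sqrt_div_sqrt_mem ht hts
  rw [funext (kernelTerm_eq (ht.trans hts) ht x y)]
  exact hasSum_mehlerKernel h0 h1 _ _

theorem summable_kernelTerm {s t : ℝ} (ht : 0 < t) (hts : t < s) (x y : ℝ) (N : ℕ) :
    Summable fun k => kernelTerm s x t y (N + k) := by
  simp only [add_comm N]
  exact (summable_nat_add_iff N).2 (hasSum_kernelTerm ht hts x y).summable

theorem sum_hermiteQ_mul_hermiteP {s t : ℝ} (hs : 0 < s) (ht : 0 < t) (N : ℕ) (x y : ℝ) :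
    ∑ k : Fin N, hermiteQ s k x * hermiteP t k y =
      1 / Real.sqrt (2 * s) * ∑ k ∈ Finset.range N, kernelTerm s x t y k := by
  rw [Finset.sum_range, Finset.mul_sum]
  refine Finset.sum_congr rfl fun k _ => ?_
  rw [kernelTerm_eq hs ht, hermiteQ, hermiteP, div_pow]
  field_simp

/-- For decreasing times, the infinite series of the kernel is Mehler's series minus its first `N`
terms. -/
theorem hermiteKernel_eq {s t : ℝ} (hs : 0 < s) (ht : 0 < t) (N : ℕ) (x y : ℝ) :
    hermiteKernel N s x t y = ∑ k : Fin N, hermiteQ s k x * hermiteP t k y -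
      if t < s then hermiteT s x t y else 0 := by
  rw [sum_hermiteQ_mul_hermiteP hs ht, hermiteKernel]
  by_cases h : s ≤ t
  · rw [if_pos h, if_neg h.not_gt, sub_zero]
  · have hts := not_le.1 h
    have hsum := hasSum_kernelTerm ht hts x y
    have h1 := hsum.summable.sum_add_tsum_nat_add N
    rw [hsum.tsum_eq] at h1
    rw [if_neg h, if_pos hts, hermiteT, ← h1]
    simp only [add_comm N]
    ring

/-! ### The multitime density as a determinant -/

/-- Hermite polynomials are polynomials, with leading coefficient `2 ^ k`. -/
theorem exists_monic_hermiteH (k : ℕ) : ∃ p : Polynomial ℝ, p.Monic ∧ p.natDegree = k ∧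
    ∀ x, hermiteH k x = 2 ^ k * p.eval x := by
  induction k using Nat.strong_induction_on with
  | _ k ih =>
    match k with
    | 0 => exact ⟨1, Polynomial.monic_one, Polynomial.natDegree_one, fun x => by
        simp [hermiteH_zero]⟩
    | 1 => exact ⟨Polynomial.X, Polynomial.monic_X, Polynomial.natDegree_X, fun x => by
        simp [hermiteH_one]⟩
    | k + 2 =>
      obtain ⟨p, hp, hpd, hpe⟩ := ih (k + 1) (by omega)
      obtain ⟨q, hq, hqd, hqe⟩ := ih k (by omega)
      have hm : (Polynomial.X * p).Monic := Polynomial.monic_X.mul hp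
      have hd : (Polynomial.X * p).natDegree = k + 2 := by
        rw [Polynomial.natDegree_X_mul hp.ne_zero, hpd]
      have hlt : (Polynomial.C (((k : ℝ) + 1) / 2) * q).natDegree < (Polynomial.X * p).natDegree :=
        (Polynomial.natDegree_C_mul_le _ _).trans_lt (by omega)
      refine ⟨Polynomial.X * p - Polynomial.C (((k : ℝ) + 1) / 2) * q,
        hm.sub_of_left (Polynomial.degree_lt_degree hlt), ?_, fun x => ?_⟩
      · rw [Polynomial.natDegree_sub_eq_left_of_natDegree_lt hlt, hd]
      · rw [hermiteH_add_two, hpe, hqe]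
        simp only [Polynomial.eval_sub, Polynomial.eval_mul, Polynomial.eval_X, Polynomial.eval_C]
        ring

theorem vandermonde_eq_det {N : ℕ} (x : Fin N → ℝ) :
    vandermonde x = (Matrix.vandermonde x).det := by
  rw [Matrix.det_vandermonde, vandermonde]

theorem vandermonde_div {N : ℕ} (x : Fin N → ℝ) (c : ℝ) :
    vandermonde (fun j => x j / c) = (∏ k : Fin N, (c ^ (k : ℕ))⁻¹) * vandermonde x := by
  rw [vandermonde_eq_det, vandermonde_eq_det, ← Matrix.det_mul_row]
  congr 1
  ext j k
  simp [Matrix.vandermonde_apply, div_pow]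
  ring

theorem det_hermiteFun {N : ℕ} (x : Fin N → ℝ) :
    (Matrix.of fun j k : Fin N => hermiteFun k (x j)).det =
      (∏ k : Fin N, 2 ^ (k : ℕ) / Real.sqrt (Real.sqrt Real.pi * 2 ^ (k : ℕ) *
        ((k : ℕ).factorial : ℝ))) * Real.exp (-(∑ j, x j ^ 2) / 2) * vandermonde x := by
  choose p hp hpd hpe using exists_monic_hermiteH
  have h1 : (Matrix.of fun j k : Fin N => hermiteFun k (x j)) =
      Matrix.of fun j k : Fin N => Real.exp (-x j ^ 2 / 2) *
        (Matrix.of fun j k : Fin N => 2 ^ (k : ℕ) / Real.sqrt (Real.sqrt Real.pi * 2 ^ (k : ℕ) *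
          ((k : ℕ).factorial : ℝ)) *
            (Matrix.of fun j k : Fin N => (p k).eval (x j)) j k) j k := by
    ext j k
    simp only [Matrix.of_apply, hermiteFun, hpe]
    ring
  rw [h1, Matrix.det_mul_column, Matrix.det_mul_row,
    ← Matrix.det_eval_matrixOfPolynomials_eq_det_vandermonde x (fun k => p k)
      (fun k => hpd k) (fun k => hp k), ← vandermonde_eq_det, ← Real.exp_sum, ← Finset.sum_div,
    Finset.sum_neg_distrib]
  ring

theorem det_hermiteQ {N : ℕ} {t : ℝ} (ht : 0 < t) (x : Fin N → ℝ) :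
    (Matrix.of fun j k : Fin N => hermiteQ t k (x j)).det =
      (∏ k : Fin N, 2 ^ (k : ℕ) / Real.sqrt (Real.sqrt Real.pi * 2 ^ (k : ℕ) *
        ((k : ℕ).factorial : ℝ)) / (Real.sqrt 2 * Real.sqrt 2 ^ (k : ℕ) * Real.sqrt t *
          t ^ (k : ℕ))) * Real.exp (-(∑ j, x j ^ 2) / (4 * t)) * vandermonde x := by
  have h1 : (Matrix.of fun j k : Fin N => hermiteQ t k (x j)) =
      Matrix.of fun j k : Fin N => 1 / Real.sqrt (2 * t) * (Real.sqrt t ^ (k : ℕ))⁻¹ *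
        (Matrix.of fun j k : Fin N => hermiteFun k (x j / Real.sqrt (2 * t))) j k := rfl
  rw [h1, Matrix.det_mul_row, det_hermiteFun fun j => x j / Real.sqrt (2 * t), vandermonde_div]
  have h2 : -(∑ j, (x j / Real.sqrt (2 * t)) ^ 2) / 2 = -(∑ j, x j ^ 2) / (4 * t) := by
    simp only [div_pow, Real.sq_sqrt (by positivity : 0 ≤ 2 * t)]
    rw [← Finset.sum_div]
    field_simp
    ring
  rw [h2]
  have h3 : (∏ k : Fin N, 1 / Real.sqrt (2 * t) * (Real.sqrt t ^ (k : ℕ))⁻¹) *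
      (∏ k : Fin N, 2 ^ (k : ℕ) / Real.sqrt (Real.sqrt Real.pi * 2 ^ (k : ℕ) *
        ((k : ℕ).factorial : ℝ))) * ∏ k : Fin N, (Real.sqrt (2 * t) ^ (k : ℕ))⁻¹ =
      ∏ k : Fin N, 2 ^ (k : ℕ) / Real.sqrt (Real.sqrt Real.pi * 2 ^ (k : ℕ) *
        ((k : ℕ).factorial : ℝ)) / (Real.sqrt 2 * Real.sqrt 2 ^ (k : ℕ) * Real.sqrt t *
          t ^ (k : ℕ)) := by
    rw [← Finset.prod_mul_distrib, ← Finset.prod_mul_distrib]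
    refine Finset.prod_congr rfl fun k _ => ?_
    have h4 : t ^ (k : ℕ) = Real.sqrt t ^ (k : ℕ) * Real.sqrt t ^ (k : ℕ) := by
      rw [← mul_pow, Real.mul_self_sqrt ht.le]
    rw [Real.sqrt_mul zero_le_two, mul_pow, h4]
    field_simp
  rw [← h3]
  ring

theorem det_hermiteP {N : ℕ} {t : ℝ} (ht : 0 < t) (x : Fin N → ℝ) :
    (Matrix.of fun k j : Fin N => hermiteP t k (x j)).det =
      (∏ k : Fin N, 2 ^ (k : ℕ) / Real.sqrt (Real.sqrt Real.pi * 2 ^ (k : ℕ) *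
        ((k : ℕ).factorial : ℝ)) / Real.sqrt 2 ^ (k : ℕ)) *
        Real.exp (-(∑ j, x j ^ 2) / (4 * t)) * vandermonde x := by
  have h1 : (Matrix.of fun k j : Fin N => hermiteP t k (x j)) =
      (Matrix.of fun j k : Fin N => (Real.sqrt 2 * t * Real.sqrt t ^ (k : ℕ) *
        Real.sqrt t ^ (k : ℕ) * Real.sqrt t / t) *
          (Matrix.of fun j k : Fin N => hermiteQ t k (x j)) j k).transpose := by
    ext k j
    simp only [Matrix.of_apply, Matrix.transpose_apply, hermiteP, hermiteQ]
    rw [Real.sqrt_mul zero_le_two]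
    field_simp
  rw [h1, Matrix.det_transpose, Matrix.det_mul_row, det_hermiteQ ht, ← mul_assoc, ← mul_assoc,
    ← Finset.prod_mul_distrib]
  congr 2
  refine Finset.prod_congr rfl fun k _ => ?_
  have h4 : t ^ (k : ℕ) = Real.sqrt t ^ (k : ℕ) * Real.sqrt t ^ (k : ℕ) := by
    rw [← mul_pow, Real.mul_self_sqrt ht.le]
  rw [h4]
  field_simp

theorem hermiteT_eq_heatKernel {s t : ℝ} (ht : 0 < t) (hts : t < s) (x y : ℝ) :
    hermiteT s x t y = Real.exp (x ^ 2 / (4 * s)) *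
      (Real.exp (-y ^ 2 / (4 * t)) * heatKernel (s - t) x y) := by
  have hs : 0 < s := ht.trans hts
  have hst : 0 < s - t := sub_pos.2 hts
  have hr : 1 - (Real.sqrt t / Real.sqrt s) ^ 2 = (s - t) / s := by
    rw [div_pow, Real.sq_sqrt ht.le, Real.sq_sqrt hs.le]
    field_simp
  have hr' : 1 + (Real.sqrt t / Real.sqrt s) ^ 2 = (s + t) / s := by
    rw [div_pow, Real.sq_sqrt ht.le, Real.sq_sqrt hs.le]
    field_simp
  have hc : 4 * (Real.sqrt t / Real.sqrt s) * (x / Real.sqrt (2 * s)) * (y / Real.sqrt (2 * t)) =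
      2 * x * y / s := by
    rw [Real.sqrt_mul zero_le_two, Real.sqrt_mul zero_le_two]
    have h2 : Real.sqrt 2 * Real.sqrt 2 = 2 := Real.mul_self_sqrt zero_le_two
    have h3 : Real.sqrt s * Real.sqrt s = s := Real.mul_self_sqrt hs.le
    have h4 : 4 * (Real.sqrt t / Real.sqrt s) * (x / (Real.sqrt 2 * Real.sqrt s)) *
        (y / (Real.sqrt 2 * Real.sqrt t)) =
          4 * x * y / ((Real.sqrt 2 * Real.sqrt 2) * (Real.sqrt s * Real.sqrt s)) := by
      field_simp
    rw [h4, h2, h3]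
    field_simp
    ring
  rw [hermiteT, mehlerKernel, heatKernel, hr, hr', hc, div_pow, div_pow,
    Real.sq_sqrt (by positivity), Real.sq_sqrt (by positivity)]
  have h5 : 1 / Real.sqrt (2 * s) * (1 / Real.sqrt (Real.pi * ((s - t) / s))) =
      (Real.sqrt (2 * Real.pi * (s - t)))⁻¹ := by
    rw [div_mul_div_comm, one_mul, one_div, ← Real.sqrt_mul (by positivity)]
    congr 2
    field_simp
  have h6 : -((s + t) / s * (x ^ 2 / (2 * s) + y ^ 2 / (2 * t)) - 2 * x * y / s) /
      (2 * ((s - t) / s)) = x ^ 2 / (4 * s) + (-y ^ 2 / (4 * t) + -(x - y) ^ 2 / (2 * (s - t))) := by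
    field_simp
    ring
  rw [h6, Real.exp_add, Real.exp_add, ← mul_assoc, h5]
  ring

theorem det_hermiteT {N : ℕ} {s t : ℝ} (ht : 0 < t) (hts : t < s) (y x : Fin N → ℝ) :
    (Matrix.of fun j k : Fin N => hermiteT s (y j) t (x k)).det =
      Real.exp ((∑ j, y j ^ 2) / (4 * s)) / Real.exp ((∑ j, x j ^ 2) / (4 * t)) *
        karlinMcGregor (s - t) y x := by
  have h1 : (Matrix.of fun j k : Fin N => hermiteT s (y j) t (x k)) =
      Matrix.of fun j k : Fin N => Real.exp (y j ^ 2 / (4 * s)) *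
        (Matrix.of fun j k : Fin N => Real.exp (-x k ^ 2 / (4 * t)) *
          (Matrix.of fun j k : Fin N => heatKernel (s - t) (y j) (x k)) j k) j k := by
    ext j k
    exact hermiteT_eq_heatKernel ht hts _ _
  rw [h1, Matrix.det_mul_column, Matrix.det_mul_row, karlinMcGregor, ← Real.exp_sum,
    ← Real.exp_sum, ← Finset.sum_div, ← Finset.sum_div, Finset.sum_neg_distrib, neg_div,
    Real.exp_neg, ← mul_assoc, div_eq_mul_inv (Real.exp _)]

theorem karlinMcGregor_eq_zero {N : ℕ} (t : ℝ) (y : Fin N → ℝ) {x : Fin N → ℝ}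
    (h : vandermonde x = 0) : karlinMcGregor t y x = 0 := by
  obtain ⟨j, -, hj⟩ := Finset.prod_eq_zero_iff.1 h
  obtain ⟨k, hk, hjk⟩ := Finset.prod_eq_zero_iff.1 hj
  refine Matrix.det_zero_of_column_eq (Finset.mem_Ioi.1 hk).ne fun i => ?_
  rw [Matrix.of_apply, Matrix.of_apply, sub_eq_zero.1 hjk]

/-- A telescoping product, in which a vanishing denominator is compensated by another factor. -/
theorem mul_prod_div_mul {M : ℕ} (V : Fin (M + 1) → ℝ) (D : Fin M → ℝ)
    (h : ∀ m, V m.castSucc = 0 → D m = 0) :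
    V 0 * ∏ m, (V m.succ / V m.castSucc * D m) = V (Fin.last M) * ∏ m, D m := by
  induction M with
  | zero => simp
  | succ M ih =>
    have := ih (fun m => V m.castSucc) (fun m => D m.castSucc) fun m => h m.castSucc
    rw [Fin.prod_univ_castSucc, Fin.prod_univ_castSucc, ← mul_assoc]
    simp only [Fin.castSucc_zero, Fin.succ_castSucc] at this ⊢
    rw [this, Fin.succ_last]
    by_cases hV : V (Fin.last M).castSucc = 0
    · rw [h _ hV]
      simp
    · field_simp

/-- The normalization of the eigenvalue distribution, as a product over the degrees `k < N`. -/
theorem gueConst_rpow {t : ℝ} (ht : 0 < t) (N : ℕ) :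
    1 / gueConst N * t ^ (-((N : ℝ) ^ 2 / 2)) =
      ∏ k : Fin N, 1 / (Real.sqrt (2 * Real.pi) * ((k : ℕ).factorial : ℝ) *
        Real.sqrt t * t ^ (k : ℕ)) := by
  induction N with
  | zero => simp [gueConst]
  | succ N ih =>
    rw [Fin.prod_univ_castSucc]
    simp only [Fin.val_castSucc, Fin.val_last]
    rw [← ih]
    have h1 : gueConst (N + 1) = gueConst N * (Real.sqrt (2 * Real.pi) * N.factorial) := by
      rw [gueConst, gueConst, Finset.prod_Icc_succ_top (by omega), Real.sqrt_eq_rpow]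
      push_cast
      rw [Real.Gamma_nat_eq_factorial, add_div, Real.rpow_add (by positivity)]
      ring
    have h2 : t ^ (-(((N + 1 : ℕ) : ℝ) ^ 2 / 2)) =
        t ^ (-((N : ℝ) ^ 2 / 2)) * (Real.sqrt t * t ^ N)⁻¹ := by
      rw [Real.sqrt_eq_rpow, ← Real.rpow_natCast t N, ← Real.rpow_add ht, ← Real.rpow_neg ht.le,
        ← Real.rpow_add ht]
      congr 1
      push_cast
      ring
    rw [h1, h2]
    field_simp

/-- The multitime density is the determinant of the extended kernel at full configurations. This
holds for all real arguments: where two coordinates of some `x m` coincide, both sides vanish. -/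
theorem multitimeDensity_eq_detK {N M : ℕ} {t : Fin (M + 1) → ℝ} (ht : StrictMono t)
    (h0 : ∀ m, 0 < t m) {E : ExtendedKernel (Fin (M + 1)) N}
    (hQ : E.Q = fun m (k : Fin N) => hermiteQ (t m) k)
    (hP : E.P = fun m (k : Fin N) => hermiteP (t m) k)
    (hT : E.T = fun m n x y => hermiteT (t m) x (t n) y) (x : Fin (M + 1) → Fin N → ℝ) :
    multitimeDensity (gueDensity N (t 0)) t x =
      E.detK (Sigma.fst : (Σ _ : Fin (M + 1), Fin N) → Fin (M + 1)) (fun a => x a.1 a.2) := by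
  rw [E.detK_full]
  simp only [hQ, hP, hT]
  rw [det_hermiteQ (h0 0), det_hermiteP (h0 _)]
  simp only [det_hermiteT (h0 _) (ht (Fin.castSucc_lt_succ))]
  set V : Fin (M + 1) → ℝ := fun m => vandermonde (x m) with hV
  set e : Fin (M + 1) → ℝ := fun m => Real.exp ((∑ j, x m j ^ 2) / (4 * t m)) with he
  set D : Fin M → ℝ := fun m =>
    karlinMcGregor (t m.succ - t m.castSucc) (x m.succ) (x m.castSucc) with hD
  have he0 : ∀ m, e m ≠ 0 := fun m => (Real.exp_pos _).ne'
  -- Where `V` vanishes, so does the Karlin-McGregor determinant of the next step: the quotients of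
  -- the `V m` telescope although division by `0` gives `0`.
  have t1 : V 0 * ∏ m, (V m.succ / V m.castSucc * D m) = V (Fin.last M) * ∏ m, D m :=
    mul_prod_div_mul V D fun m h => karlinMcGregor_eq_zero _ _ h
  have t2 : ∏ m, (e m.succ / e m.castSucc * D m) = e (Fin.last M) / e 0 * ∏ m, D m := by
    have := mul_prod_div_mul e D fun m h => absurd h (he0 _)
    rw [← mul_right_inj' (he0 0), this]
    have := he0 0
    field_simp
  have hexp : ∀ m, Real.exp (-(∑ j, x m j ^ 2) / (4 * t m)) = (e m)⁻¹ := fun m => by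
    rw [neg_div, Real.exp_neg]
  have hexp0 : Real.exp (-(∑ j, x 0 j ^ 2) / (2 * t 0)) = (e 0)⁻¹ * (e 0)⁻¹ := by
    rw [← hexp, ← Real.exp_add]
    congr 1
    have := (h0 0).ne'
    field_simp
    ring
  have hconst : (∏ k : Fin N, 2 ^ (k : ℕ) / Real.sqrt (Real.sqrt Real.pi * 2 ^ (k : ℕ) *
        ((k : ℕ).factorial : ℝ)) / (Real.sqrt 2 * Real.sqrt 2 ^ (k : ℕ) * Real.sqrt (t 0) *
          t 0 ^ (k : ℕ))) *
      (∏ k : Fin N, 2 ^ (k : ℕ) / Real.sqrt (Real.sqrt Real.pi * 2 ^ (k : ℕ) *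
        ((k : ℕ).factorial : ℝ)) / Real.sqrt 2 ^ (k : ℕ)) =
      1 / gueConst N * t 0 ^ (-((N : ℝ) ^ 2 / 2)) := by
    rw [gueConst_rpow (h0 0), ← Finset.prod_mul_distrib]
    refine Finset.prod_congr rfl fun k _ => ?_
    have hk : 0 ≤ Real.sqrt Real.pi * 2 ^ (k : ℕ) * ((k : ℕ).factorial : ℝ) := by positivity
    have h3 : Real.sqrt 2 ^ (k : ℕ) * Real.sqrt 2 ^ (k : ℕ) = 2 ^ (k : ℕ) := by
      rw [← mul_pow, Real.mul_self_sqrt zero_le_two]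
    have h4 := h0 0
    rw [div_div, div_div, div_mul_div_comm]
    have h5 : Real.sqrt (Real.sqrt Real.pi * 2 ^ (k : ℕ) * ((k : ℕ).factorial : ℝ)) *
        (Real.sqrt 2 * Real.sqrt 2 ^ (k : ℕ) * Real.sqrt (t 0) * t 0 ^ (k : ℕ)) *
        (Real.sqrt (Real.sqrt Real.pi * 2 ^ (k : ℕ) * ((k : ℕ).factorial : ℝ)) *
          Real.sqrt 2 ^ (k : ℕ)) =
        2 ^ (k : ℕ) * 2 ^ (k : ℕ) * (Real.sqrt (2 * Real.pi) * ((k : ℕ).factorial : ℝ) *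
          Real.sqrt (t 0) * t 0 ^ (k : ℕ)) := by
      rw [Real.sqrt_mul zero_le_two]
      have h6 := Real.mul_self_sqrt hk
      linear_combination (Real.sqrt 2 * Real.sqrt (t 0) * t 0 ^ (k : ℕ) *
        (Real.sqrt 2 ^ (k : ℕ) * Real.sqrt 2 ^ (k : ℕ))) * h6 +
        (Real.sqrt 2 * Real.sqrt (t 0) * t 0 ^ (k : ℕ) *
          (Real.sqrt Real.pi * 2 ^ (k : ℕ) * ((k : ℕ).factorial : ℝ))) * h3
    rw [h5]
    field_simp
  rw [t2, multitimeDensity, gueDensity, hexp, hexp, hexp0, ← hconst]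
  simp only [transitionDensity]
  have h7 := he0 0
  have h8 := he0 (Fin.last M)
  change _ * V 0 ^ 2 * ∏ m, (V m.succ / V m.castSucc * D m) = _ * V 0 * _ * (_ * V (Fin.last M))
  generalize (∏ k : Fin N, 2 ^ (k : ℕ) / Real.sqrt (Real.sqrt Real.pi * 2 ^ (k : ℕ) *
        ((k : ℕ).factorial : ℝ)) / (Real.sqrt 2 * Real.sqrt 2 ^ (k : ℕ) * Real.sqrt (t 0) *
          t 0 ^ (k : ℕ))) = A
  generalize (∏ k : Fin N, 2 ^ (k : ℕ) / Real.sqrt (Real.sqrt Real.pi * 2 ^ (k : ℕ) *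
        ((k : ℕ).factorial : ℝ)) / Real.sqrt 2 ^ (k : ℕ)) = B
  have h9 : ∀ W, A * B * ((e 0)⁻¹ * (e 0)⁻¹) * V 0 ^ 2 * W =
      A * B * ((e 0)⁻¹ * (e 0)⁻¹) * V 0 * (V 0 * W) := fun W => by ring
  rw [h9, t1]
  field_simp

/-! ### Ordered and unordered configurations -/

theorem ae_injective (N : ℕ) : ∀ᵐ x : Fin N → ℝ, Function.Injective x := by
  have h : ∀ i j : Fin N, i ≠ j → ∀ᵐ x : Fin N → ℝ, x i ≠ x j := fun i j hij => by
    have hs : LinearMap.ker ((LinearMap.proj i : (Fin N → ℝ) →ₗ[ℝ] ℝ) - LinearMap.proj j) ≠ ⊤ := by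
      intro htop
      have : Pi.single i (1 : ℝ) ∈
          LinearMap.ker ((LinearMap.proj i : (Fin N → ℝ) →ₗ[ℝ] ℝ) - LinearMap.proj j) := by
        rw [htop]
        trivial
      simp [hij.symm] at this
    refine measure_mono_null (fun x hx => ?_) (Measure.addHaar_submodule volume _ hs)
    simpa [sub_eq_zero] using hx
  have h2 : ∀ᵐ x : Fin N → ℝ, ∀ i j, i ≠ j → x i ≠ x j := by
    rw [ae_all_iff]
    intro i
    rw [ae_all_iff]
    intro j
    by_cases hij : i = j
    · simp [hij]
    · filter_upwards [h i j hij] with x hx _ using hx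
  filter_upwards [h2] with x hx i j hij
  by_contra hne
  exact hx i j hne hij

/-- Distinct coordinates can be put into increasing order by exactly one permutation. -/
theorem strictMono_comp_perm_iff {N : ℕ} {x : Fin N → ℝ} (hx : Function.Injective x)
    (σ : Equiv.Perm (Fin N)) : StrictMono (x ∘ σ) ↔ σ = Tuple.sort x := by
  have hsort : StrictMono (x ∘ Tuple.sort x) :=
    (Tuple.monotone_sort x).strictMono_of_injective (hx.comp (Tuple.sort x).injective)
  refine ⟨fun h => ?_, fun h => h ▸ hsort⟩
  have := Tuple.unique_monotone h.monotone hsort.monotone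
  ext i
  exact congrArg Fin.val (hx (congrFun this i))

/-- The configurations that are ordered at each time. -/
def orderedConfigurations (I : Type*) (N : ℕ) : Set (I → Fin N → ℝ) :=
  {x | ∀ m, x m ∈ weylChamber N}

theorem measurableSet_orderedConfigurations (I : Type*) [Fintype I] (N : ℕ) :
    MeasurableSet (orderedConfigurations I N) := by
  have : orderedConfigurations I N =
      ⋂ m : I, ⋂ i : Fin N, ⋂ j : Fin N, ⋂ _ : i < j, {x | x m i < x m j} := by
    ext x
    simp [orderedConfigurations, weylChamber, StrictMono]
  rw [this]
  refine MeasurableSet.iInter fun m => MeasurableSet.iInter fun i => MeasurableSet.iInter fun j =>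
    MeasurableSet.iInter fun _ => measurableSet_lt ?_ ?_ <;> fun_prop

/-- The integral of a function that is symmetric in the coordinates at each time is `N!` to the
number of times its integral over the ordered configurations. -/
theorem integral_eq_setIntegral_orderedConfigurations {I : Type*} [Fintype I] {N : ℕ}
    {F : (I → Fin N → ℝ) → ℝ} (hF : Integrable F)
    (hsymm : ∀ (σ : I → Equiv.Perm (Fin N)) x, F (fun m => x m ∘ σ m) = F x) :
    ∫ x, F x = (N.factorial : ℝ) ^ Fintype.card I * ∫ x in orderedConfigurations I N, F x := by
  classical
  have hpres : ∀ σ : I → Equiv.Perm (Fin N),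
      MeasurePreserving fun (x : I → Fin N → ℝ) m => x m ∘ σ m := fun σ =>
    volume_preserving_pi fun m => (measurePreserving_comp_equiv (σ m)).1
  set G : (I → Fin N → ℝ) → ℝ := (orderedConfigurations I N).indicator F with hG
  have hGi : Integrable G := hF.indicator (measurableSet_orderedConfigurations I N)
  have hsum : ∀ᵐ x : I → Fin N → ℝ, F x =
      ∑ σ : I → Equiv.Perm (Fin N), G fun m => x m ∘ σ m := by
    have hinj : ∀ᵐ x : I → Fin N → ℝ, ∀ m, Function.Injective (x m) := by
      rw [ae_all_iff]
      intro m
      exact (Measure.quasiMeasurePreserving_eval _ m).ae (ae_injective N)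
    filter_upwards [hinj] with x hx
    have hmem : ∀ σ : I → Equiv.Perm (Fin N),
        (fun m => x m ∘ σ m) ∈ orderedConfigurations I N ↔ σ = fun m => Tuple.sort (x m) := by
      intro σ
      rw [funext_iff]
      exact forall_congr' fun m => strictMono_comp_perm_iff (hx m) (σ m)
    have hGσ : ∀ σ : I → Equiv.Perm (Fin N), (G fun m => x m ∘ σ m) =
        if σ = (fun m => Tuple.sort (x m)) then F x else 0 := fun σ => by
      rw [hG, Set.indicator_apply, hsymm]
      simp only [hmem]
    simp [hGσ]
  rw [integral_congr_ae hsum, integral_finsetSum]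
  · have h : ∀ σ : I → Equiv.Perm (Fin N), ∫ x : I → Fin N → ℝ, G (fun m => x m ∘ σ m) =
        ∫ x in orderedConfigurations I N, F x := fun σ => by
      rw [← integral_indicator (measurableSet_orderedConfigurations I N), ← hG]
      have := integral_map (hpres σ).measurable.aemeasurable
        (f := G) (by rw [(hpres σ).map_eq]; exact hGi.aestronglyMeasurable)
      rw [(hpres σ).map_eq] at this
      exact this.symm
    simp [h, Fintype.card_perm]
  · intro σ _
    exact (hpres σ).integrable_comp_of_integrable hGi

namespace ExtendedKernel

theorem detK_comp_perm {I : Type*} [LinearOrder I] [Fintype I] {N : ℕ} (E : ExtendedKernel I N)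
    (σ : I → Equiv.Perm (Fin N)) (x : I → Fin N → ℝ) :
    E.detK (Sigma.fst : (Σ _ : I, Fin N) → I) (fun a => x a.1 (σ a.1 a.2)) =
      E.detK (Sigma.fst : (Σ _ : I, Fin N) → I) fun a => x a.1 a.2 :=
  E.detK_comp_equiv (Equiv.sigmaCongrRight σ) (Sigma.fst : (Σ _ : I, Fin N) → I)
    fun a => x a.1 a.2

theorem integral_detK_full {I : Type*} [LinearOrder I] [Fintype I] {N : ℕ}
    (E : ExtendedKernel I N) :
    ∫ x, E.detK (Sigma.fst : (Σ _ : I, Fin N) → I) x =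
      (N.factorial : ℝ) ^ Fintype.card I := by
  have hc : ∀ m, count (Sigma.fst : (Σ _ : I, Fin N) → I) m = N := count_sigma_fst fun _ => N
  have hc0 : ∀ m : I, count (Empty.elim : Empty → I) m = 0 := fun m => by simp [count]
  have h := E.integral_detK_sum_elim (Empty.elim : Empty → I) Empty.elim (Σ _ : I, Fin N) Sigma.fst
    fun m => by rw [hc, hc0, zero_add]
  simp only [hc, hc0, Nat.sub_zero, Nat.descFactorial_self, Finset.prod_const,
    Finset.card_univ] at h
  have h1 : E.detK (Empty.elim : Empty → I) Empty.elim = 1 := by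
    rw [detK_eq, Matrix.det_isEmpty]
  rw [h1, mul_one] at h
  rw [← h]
  refine integral_congr_ae (ae_of_all _ fun x => ?_)
  simp only
  rw [← E.detK_comp_equiv (Equiv.emptySum Empty (Σ _ : I, Fin N))]
  congr 1 <;> · funext a; rcases a with a | a; exacts [a.elim, rfl]

end ExtendedKernel

/-- A function `w` is nonnegative almost everywhere if its integral and that of its positive part are
both `1`. This yields the nonnegativity of the multitime density from its total mass, without the
positivity of the Karlin-McGregor determinants. -/
theorem ae_nonneg_of_integral_eq_one {α : Type*} [MeasurableSpace α] {μ : Measure α} {w : α → ℝ}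
    (hw : Integrable w μ) (hprob : ∫⁻ x, ENNReal.ofReal (w x) ∂μ = 1) (hint : ∫ x, w x ∂μ = 1) :
    ∀ᵐ x ∂μ, 0 ≤ w x := by
  have h1 : ∫ x, max (w x) 0 ∂μ = 1 := by
    have := integral_toReal hw.aestronglyMeasurable.aemeasurable.ennreal_ofReal
      (ae_of_all _ fun x => ENNReal.ofReal_lt_top)
    simpa only [hprob, ENNReal.toReal_ofReal', ENNReal.toReal_one] using this
  have h2 : ∫ x, (max (w x) 0 - w x) ∂μ = 0 := by
    rw [integral_sub hw.pos_part hw, h1, hint, sub_self]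
  rw [integral_eq_zero_iff_of_nonneg (fun x => sub_nonneg.2 (le_max_left _ _))
    (hw.pos_part.sub hw)] at h2
  filter_upwards [h2] with x hx
  simp only [Pi.zero_apply, sub_eq_zero] at hx
  rw [← hx]
  exact le_max_right _ _

/-! ### Correlation functions and the Fredholm expansion -/

/-- The points `x` followed by the points `y` at each time form a full configuration; up to the
order of the rows and columns, its determinant is that of the joint family. -/
theorem detK_extendPoints {N M : ℕ} (E : ExtendedKernel (Fin (M + 1)) N) {n : Fin (M + 1) → ℕ}
    (hn : ∀ m, n m ≤ N) (x : ∀ m, Fin (n m) → ℝ) (y : ∀ m, Fin (N - n m) → ℝ) :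
    E.detK (Sigma.fst : (Σ _ : Fin (M + 1), Fin N) → Fin (M + 1))
        (fun a => extendPoints (x a.1) (y a.1) a.2) =
      E.detK (Sum.elim (Sigma.fst : (Σ m, Fin (n m)) → Fin (M + 1))
          (Sigma.fst : (Σ m, Fin (N - n m)) → Fin (M + 1)))
        (Sum.elim (fun a => x a.1 a.2) fun a => y a.1 a.2) := by
  let e : (Σ m, Fin (n m)) ⊕ (Σ m, Fin (N - n m)) ≃ Σ _ : Fin (M + 1), Fin N :=
    (Equiv.sigmaSumDistrib _ _).symm.trans (Equiv.sigmaCongrRight fun m =>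
      finSumFinEquiv.trans (finCongr (Nat.add_sub_of_le (hn m))))
  rw [← E.detK_comp_equiv e]
  congr 1
  · funext a
    rcases a with ⟨m, j⟩ | ⟨m, j⟩ <;> rfl
  · funext a
    rcases a with ⟨m, j⟩ | ⟨m, j⟩
    · change extendPoints (x m) (y m) ⟨j, j.2.trans_le (hn m)⟩ = x m j
      simp [extendPoints]
    · change extendPoints (x m) (y m) ⟨n m + j, by have := j.2; have := hn m; omega⟩ = y m j
      simp [extendPoints]

variable {N M : ℕ} {t : Fin (M + 1) → ℝ} {E : ExtendedKernel (Fin (M + 1)) N}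

theorem det_kernelMatrix_mul (hK : ∀ m x n y, hermiteKernel N (t m) x (t n) y = E.K m x n y)
    {n : Fin (M + 1) → ℕ} (ψ : Fin (M + 1) → ℝ → ℝ) (x : ∀ m, Fin (n m) → ℝ) :
    (kernelMatrix (fun m x n y => hermiteKernel N (t m) x (t n) y * ψ n y) x).det =
      (∏ a : Σ m, Fin (n m), ψ a.1 (x a.1 a.2)) *
        E.detK (Sigma.fst : (Σ m, Fin (n m)) → Fin (M + 1)) (fun a => x a.1 a.2) := by
  rw [E.detK_eq, ← Matrix.det_mul_row]
  congr 1
  ext a b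
  simp only [kernelMatrix, Matrix.of_apply, ExtendedKernel.kernelMat, hK]
  ring

theorem correlation_eq_det (hK : ∀ m x n y, hermiteKernel N (t m) x (t n) y = E.K m x n y)
    {ν : (Fin N → ℝ) → ℝ} (hE : ∀ x : Fin (M + 1) → Fin N → ℝ, multitimeDensity ν t x =
      E.detK (Sigma.fst : (Σ _ : Fin (M + 1), Fin N) → Fin (M + 1)) fun a => x a.1 a.2)
    {n : Fin (M + 1) → ℕ} (hn : ∀ m, n m ≤ N) (x : ∀ m, Fin (n m) → ℝ) :
    Integrable (fun y : (∀ m, Fin (N - n m) → ℝ) =>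
        multitimeDensity ν t (fun m => extendPoints (x m) (y m))) ∧
      correlation ν t n x =
        (kernelMatrix (fun m x n y => hermiteKernel N (t m) x (t n) y) x).det := by
  have hdet : (kernelMatrix (fun m x n y => hermiteKernel N (t m) x (t n) y) x).det =
      E.detK (Sigma.fst : (Σ m, Fin (n m)) → Fin (M + 1)) (fun a => x a.1 a.2) := by
    simpa using det_kernelMatrix_mul hK (fun _ _ => 1) x
  have hc : ∀ m, count (Sigma.fst : (Σ m, Fin (n m)) → Fin (M + 1)) m = n m := count_sigma_fst n
  have hc' : ∀ m, count (Sigma.fst : (Σ m, Fin (N - n m)) → Fin (M + 1)) m = N - n m :=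
    count_sigma_fst fun m => N - n m
  rw [correlation, hdet]
  simp only [hE, detK_extendPoints E hn]
  refine ⟨integrable_sigma_uncurry (E.integrable_detK_sum_elim
    (Sigma.fst : (Σ m, Fin (n m)) → Fin (M + 1))
    (Sigma.fst : (Σ m, Fin (N - n m)) → Fin (M + 1)) fun a => x a.1 a.2), ?_⟩
  rw [integral_mul_const, integral_sigma_uncurry fun y => E.detK (Sum.elim
      (Sigma.fst : (Σ m, Fin (n m)) → Fin (M + 1))
      (Sigma.fst : (Σ m, Fin (N - n m)) → Fin (M + 1))) (Sum.elim (fun a => x a.1 a.2) y),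
    E.integral_detK_sum_elim _ _ _ _ fun m => by rw [hc, hc']; exact (Nat.add_sub_of_le (hn m)).le]
  simp only [hc, hc', Nat.descFactorial_self]
  rw [mul_right_comm, ← Finset.prod_mul_distrib]
  have : ∀ m, ((N - n m).factorial : ℝ) * (1 / ((N - n m).factorial : ℝ)) = 1 := fun m => by
    field_simp
  simp only [this, Finset.prod_const_one, one_mul]

/-- The generating function of the process, as an integral over all configurations. -/
theorem integral_exp_eq_integral_detK {Ω : Type*} [MeasurableSpace Ω] {P : Measure Ω}
    [IsProbabilityMeasure P] {t₀ : ℝ} {ν : (Fin N → ℝ) → ℝ} {X : ℝ → Ω → Fin N → ℝ}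
    (hX : IsNoncollidingBM P t₀ ν X) (ht : StrictMono t) (ht0 : t 0 = t₀)
    (hE : ∀ x : Fin (M + 1) → Fin N → ℝ, multitimeDensity ν t x =
      E.detK (Sigma.fst : (Σ _ : Fin (M + 1), Fin N) → Fin (M + 1)) fun a => x a.1 a.2)
    {ψ : Fin (M + 1) → ℝ → ℝ} {B : ℝ} (hψ : ∀ m, Continuous (ψ m)) (hB : ∀ m z, |ψ m z| ≤ B) :
    Integrable (fun ω => ∏ m, ∏ j, ψ m (X (t m) ω j)) P ∧
    (N.factorial : ℝ) ^ Fintype.card (Fin (M + 1)) * ∫ ω, ∏ m, ∏ j, ψ m (X (t m) ω j) ∂P =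
      ∫ x : (Σ _ : Fin (M + 1), Fin N) → ℝ, (∏ a, ψ a.1 (x a)) *
        E.detK (Sigma.fst : (Σ _ : Fin (M + 1), Fin N) → Fin (M + 1)) x := by
  have hmeas : Measurable fun ω (m : Fin (M + 1)) => X (t m) ω :=
    measurable_pi_lambda _ fun m => hX.measurable _ (ht0 ▸ ht.monotone (Fin.zero_le m))
  set G : (Fin (M + 1) → Fin N → ℝ) → ℝ := fun x => ∏ m, ∏ j, ψ m (x m j) with hG
  have hGc : Continuous G := by
    refine continuous_finsetProd _ fun m _ => continuous_finsetProd _ fun j _ => (hψ m).comp ?_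
    fun_prop
  have hGb : ∀ x, |G x| ≤ ∏ _m : Fin (M + 1), ∏ _j : Fin N, B := fun x => by
    simp only [hG, Finset.abs_prod]
    exact Finset.prod_le_prod (fun _ _ => Finset.prod_nonneg fun _ _ => abs_nonneg _) fun m _ =>
      Finset.prod_le_prod (fun _ _ => abs_nonneg _) fun j _ => hB _ _
  refine ⟨Integrable.of_bound (hGc.measurable.comp hmeas).aestronglyMeasurable _
    (ae_of_all _ fun ω => hGb _), ?_⟩
  set W := orderedConfigurations (Fin (M + 1)) N
  set w : (Fin (M + 1) → Fin N → ℝ) → ℝ := multitimeDensity ν t with hw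
  have hwE : ∀ x, w x =
      E.detK (Sigma.fst : (Σ _ : Fin (M + 1), Fin N) → Fin (M + 1)) fun a => x a.1 a.2 := hE
  have hwc : Continuous w := by
    rw [funext hwE]
    exact (E.continuous_detK _).comp (by fun_prop)
  have hlaw : P.map (fun ω (m : Fin (M + 1)) => X (t m) ω) =
      (volume.restrict W).withDensity fun x => ENNReal.ofReal (w x) := hX.law M t ht ht0
  have hone : ∀ a : Σ _ : Fin (M + 1), Fin N, Continuous fun _ : ℝ => (1 : ℝ) :=
    fun _ => continuous_const
  have hwi : Integrable w := by
    have h := integrable_sigma_uncurry (E.integrable_prod_mul_detK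
      (Sigma.fst : (Σ _ : Fin (M + 1), Fin N) → Fin (M + 1)) hone (B := 1) fun _ _ => by simp)
    simp only [Finset.prod_const_one, one_mul] at h
    rwa [funext hwE]
  have hwsymm : ∀ (σ : Fin (M + 1) → Equiv.Perm (Fin N)) x,
      w (fun m => x m ∘ σ m) = w x := fun σ x => by
    rw [hwE, hwE]
    exact E.detK_comp_perm σ x
  -- The positive part of `w` has integral `1` over `W` because `P` is a probability measure, and `w`
  -- itself because all points can be integrated out of the determinant.
  have hpos : ∀ᵐ x ∂volume.restrict W, 0 ≤ w x := by
    refine ae_nonneg_of_integral_eq_one hwi.integrableOn ?_ ?_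
    · have h := congrArg (fun μ => μ Set.univ) hlaw
      simp only [withDensity_apply _ MeasurableSet.univ, Measure.restrict_univ] at h
      rw [← h, Measure.map_apply hmeas MeasurableSet.univ, Set.preimage_univ, measure_univ]
    · have h := integral_eq_setIntegral_orderedConfigurations hwi hwsymm
      have h2 : ∫ x, w x = (N.factorial : ℝ) ^ Fintype.card (Fin (M + 1)) := by
        rw [← E.integral_detK_full, ← integral_sigma_uncurry]
        exact integral_congr_ae (ae_of_all _ hwE)
      rw [h2] at h
      exact (mul_left_cancel₀ (by positivity) ((mul_one _).trans h)).symm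
  have hGw : Integrable fun x => G x * w x :=
    hwi.bdd_mul hGc.aestronglyMeasurable (ae_of_all _ hGb)
  have hGsymm : ∀ (σ : Fin (M + 1) → Equiv.Perm (Fin N)) x,
      G (fun m => x m ∘ σ m) * w (fun m => x m ∘ σ m) = G x * w x := fun σ x => by
    rw [hwsymm]
    congr 1
    exact Finset.prod_congr rfl fun m _ => Equiv.prod_comp (σ m) fun j => ψ m (x m j)
  have h1 : ∫ ω, G (fun m => X (t m) ω) ∂P = ∫ x in W, G x * w x := by
    rw [← integral_map hmeas.aemeasurable hGc.aestronglyMeasurable, hlaw,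
      integral_withDensity_eq_integral_toReal_smul hwc.measurable.ennreal_ofReal
        (ae_of_all _ fun x => ENNReal.ofReal_lt_top)]
    refine integral_congr_ae ?_
    filter_upwards [hpos] with x hx
    rw [ENNReal.toReal_ofReal hx, smul_eq_mul, mul_comm]
  change _ * ∫ ω, G (fun m => X (t m) ω) ∂P = _
  rw [h1, ← integral_eq_setIntegral_orderedConfigurations hGw hGsymm,
    ← integral_sigma_uncurry fun x : (Σ _ : Fin (M + 1), Fin N) → ℝ => (∏ a, ψ a.1 (x a)) *
        E.detK (Sigma.fst : (Σ _ : Fin (M + 1), Fin N) → Fin (M + 1)) x]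
  refine integral_congr_ae (ae_of_all _ fun x => ?_)
  simp only [hG, hwE, Fintype.prod_sigma]

theorem fredholmTerm_eq (hK : ∀ m x n y, hermiteKernel N (t m) x (t n) y = E.K m x n y)
    (ψ : Fin (M + 1) → ℝ → ℝ) (n : Fin (M + 1) → ℕ) :
    fredholmTerm (fun m x n y => hermiteKernel N (t m) x (t n) y * ψ n y) n =
      (∏ m, (1 / ((n m).factorial : ℝ))) *
        E.weightedIntegral (Sigma.fst : (Σ m, Fin (n m)) → Fin (M + 1)) ψ := by
  rw [fredholmTerm, ExtendedKernel.weightedIntegral, ← integral_sigma_uncurry]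
  simp only [det_kernelMatrix_mul hK]

end NoncollidingBM

open NoncollidingBM in
theorem mainTheorem1 {Ω : Type*} [MeasurableSpace Ω] (P : Measure Ω) [IsProbabilityMeasure P]
    (N : ℕ) (t₀ : ℝ) (ht₀ : 0 < t₀) (X : ℝ → Ω → Fin N → ℝ)
    (hX : IsNoncollidingBM P t₀ (gueDensity N t₀) X)
    (M : ℕ) (t : Fin (M + 1) → ℝ) (ht : StrictMono t) (ht0 : t 0 = t₀) :
    -- the series that defines the kernel for decreasing times converges
    (∀ m n : Fin (M + 1), n < m → ∀ x y : ℝ,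
      Summable fun k : ℕ => kernelTerm (t m) x (t n) y (N + k)) ∧
    -- (i) the multitime generating function is a Fredholm determinant
    (∀ (f : Fin (M + 1) → ℝ → ℝ), (∀ m, Continuous (f m)) → (∀ m, HasCompactSupport (f m)) →
      ∀ θ : Fin (M + 1) → ℝ,
      let Ψ : ℝ := ∫ ω, Real.exp (∑ m, θ m * ∑ j, f m (X (t m) ω j)) ∂P
      let Kχ : Fin (M + 1) → ℝ → Fin (M + 1) → ℝ → ℝ :=
        fun m x n y => hermiteKernel N (t m) x (t n) y * (Real.exp (θ n * f n y) - 1)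
      Integrable (fun ω => Real.exp (∑ m, θ m * ∑ j, f m (X (t m) ω j))) P ∧
      (∀ n : Fin (M + 1) → ℕ,
        Integrable (fun x : (∀ m, Fin (n m) → ℝ) => (kernelMatrix Kχ x).det)) ∧
      Summable (fredholmTerm Kχ) ∧
      Ψ = fredholmDet Kχ ∧
      Ψ = ∑ n ∈ Fintype.piFinset (fun _ : Fin (M + 1) => Finset.range (N + 1)),
        fredholmTerm Kχ n) ∧
    -- (ii) every multitime correlation function is a determinant
    (∀ n : Fin (M + 1) → ℕ, (∀ m, n m ≤ N) → ∀ x : (∀ m, Fin (n m) → ℝ),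
      Integrable (fun y : (∀ m, Fin (N - n m) → ℝ) =>
        multitimeDensity (gueDensity N t₀) t (fun m => extendPoints (x m) (y m))) ∧
      correlation (gueDensity N t₀) t n x =
        (kernelMatrix (fun m x n y => hermiteKernel N (t m) x (t n) y) x).det) := by
  have h0 : ∀ m, 0 < t m := fun m => (ht0 ▸ ht₀ : 0 < t 0).trans_le (ht.monotone (Fin.zero_le m))
  obtain ⟨E, hQ, hP, hT⟩ := exists_extendedKernel N ht h0
  have hK : ∀ m x n y, hermiteKernel N (t m) x (t n) y = E.K m x n y := fun m x n y => by
    simp only [hermiteKernel_eq (h0 m) (h0 n), ExtendedKernel.K, hQ, hP, hT, ht.lt_iff_lt]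
  have hE := multitimeDensity_eq_detK ht h0 hQ hP hT
  rw [ht0] at hE
  refine ⟨fun m n h x y => summable_kernelTerm (h0 n) (ht h) x y N, ?_,
    fun n hn x => correlation_eq_det hK hE hn x⟩
  intro f hf hfc θ Ψ Kχ
  set χ : Fin (M + 1) → ℝ → ℝ := fun m z => Real.exp (θ m * f m z) - 1 with hχ
  have hχc : ∀ m, Continuous (χ m) := fun m =>
    (Real.continuous_exp.comp (continuous_const.mul (hf m))).sub continuous_const
  obtain ⟨B, hB⟩ : ∃ B, ∀ m z, |χ m z| ≤ B := by
    have h : ∀ m, ∃ C, ∀ z, |χ m z| ≤ C := fun m =>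
      ((hfc m).comp_left (g := fun u => Real.exp (θ m * u) - 1)
        (by simp)).exists_bound_of_continuous (hχc m)
    choose C hC using h
    exact ⟨∑ m, C m, fun m z => (hC m z).trans (Finset.single_le_sum (f := C)
      (fun m _ => (abs_nonneg _).trans (hC m 0)) (Finset.mem_univ m))⟩
  have hexp : ∀ ω, Real.exp (∑ m, θ m * ∑ j, f m (X (t m) ω j)) =
      ∏ m, ∏ j, (1 + χ m (X (t m) ω j)) := fun ω => by
    simp only [hχ, Finset.mul_sum, Real.exp_sum, add_sub_cancel]
  obtain ⟨hi, hΨ⟩ := integral_exp_eq_integral_detK hX ht ht0 hE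
    (ψ := fun m z => 1 + χ m z) (B := 1 + B) (fun m => continuous_const.add (hχc m))
    fun m z => (abs_add_le _ _).trans (by rw [abs_one]; exact add_le_add_right (hB m z) 1)
  have hterm : ∀ n, fredholmTerm Kχ n = (∏ m, (1 / ((n m).factorial : ℝ))) *
      E.weightedIntegral (Sigma.fst : (Σ m, Fin (n m)) → Fin (M + 1)) χ :=
    fredholmTerm_eq hK χ
  have hzero : ∀ n ∉ Fintype.piFinset (fun _ : Fin (M + 1) => Finset.range (N + 1)),
      fredholmTerm Kχ n = 0 := fun n hn => by
    simp only [Fintype.mem_piFinset, Finset.mem_range, not_forall, not_lt] at hn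
    obtain ⟨m, hm⟩ := hn
    rw [hterm, E.weightedIntegral_eq_zero χ hm, mul_zero]
  have hsum : Ψ = ∑ n ∈ Fintype.piFinset (fun _ : Fin (M + 1) => Finset.range (N + 1)),
      fredholmTerm Kχ n := by
    rw [E.integral_prod_one_add_mul_detK hχc hB] at hΨ
    simp only [Ψ, hexp, hterm]
    exact mul_left_cancel₀ (by positivity) hΨ
  refine ⟨?_, fun n => ?_, summable_of_ne_finset_zero hzero, ?_, hsum⟩
  · simpa only [hexp] using hi
  · have h : ∀ x : (∀ m, Fin (n m) → ℝ), (kernelMatrix Kχ x).det = _ :=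
      fun x => det_kernelMatrix_mul hK χ x
    simp only [h]
    exact integrable_sigma_uncurry (E.integrable_prod_mul_detK
      (Sigma.fst : (Σ m, Fin (n m)) → Fin (M + 1)) (ψ := fun a => χ a.1) (fun a => hχc _)
        fun a z => hB _ _)
  · rw [hsum, fredholmDet, tsum_eq_sum hzero]
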